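/- **Definitions.** Let $G$ be a finite graph and let $k\ge 0$ and $m\ge 1$ be integers. In the *$k$-visibility localization game* on $G$ an invisible robber chooses a starting vertex. In each round, $m$ cops are placed on arbitrary vertices $c_1,\dots,c_m$ of $G$ (not necessarily near their previous positions), and for each $i$ the cops are told the distance from $c_i$ to the robber's vertex if this distance is at most $k$, and are told only that it exceeds $k$ otherwise. After that the robber stays put or moves to an adjacent vertex, and the next round begins. The cops win if they have a strategy (each placement depending only on the information received in earlier rounds) that, whatever the robber does, after finitely many rounds and right after a probe leaves exactly one vertex as the possible position of the robber, given all information received so far. The *$k$-proximity game* is played in the same way, except that the cops win if they have a strategy that, whatever the robber does, after finitely many rounds places some cop at distance at most $k$ from the robber. The *$k$-visibility localization number* $\zeta_k(G)$ and the *$k$-proximity number* $\mathrm{prox}_k(G)$ are the least $m\ge 1$ for which $m$ cops win the respective game. The depth of a rooted tree is the largest distance of a vertex from the root. **Theorem.** For all integers $d\ge 3$, $q\ge 4$ and $k\ge 0$ there is a rooted tree $T$ of depth $d$ and maximum degree $q$ such that $$\zeta_k(T)\ \ge\ \mathrm{prox}_k(T)\ >\ \frac14\cdot\frac{d-(k+1)}{(2k+1)^2}.$$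 -/

import Mathlib

namespace VisibilityGame

variable {V : Type*}

/-- The information returned by one cop standing on `c` when the robber is on `x`: the distance
from `c` to `x` if it is at most `k`, and `⊤` (nothing seen) otherwise. -/
noncomputable def signal (G : SimpleGraph V) (k : ℕ) (c x : V) : ℕ∞ :=
  open Classical in if G.edist c x ≤ (k : ℕ∞) then G.edist c x else ⊤

/-- A robber trajectory: `ρ t` is the position of the robber in round `t`, and between two rounds
the robber stays put or moves along an edge. -/
def IsTrajectory (G : SimpleGraph V) (ρ : ℕ → V) : Prop :=
  ∀ t, ρ (t + 1) = ρ t ∨ G.Adj (ρ t) (ρ (t + 1))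

/-- A strategy of `m` cops: the vertices probed in a round, as a function of the list of the
distance vectors received in all earlier rounds. The cops may be placed on any vertices. -/
abbrev Strategy (V : Type*) (m : ℕ) : Type _ := List (Fin m → ℕ∞) → Fin m → V

/-- The distance vectors received in rounds `0, …, t - 1` when the cops follow `σ` and the robber
follows `ρ`. -/
noncomputable def transcript (G : SimpleGraph V) (k : ℕ) {m : ℕ} (σ : Strategy V m) (ρ : ℕ → V) :
    ℕ → List (Fin m → ℕ∞)
  | 0 => []
  | t + 1 => transcript G k σ ρ t ++ [fun i => signal G k (σ (transcript G k σ ρ t) i) (ρ t)]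

/-- The vertices probed in round `t` when the cops follow `σ` and the robber follows `ρ`. -/
noncomputable def placement (G : SimpleGraph V) (k : ℕ) {m : ℕ} (σ : Strategy V m) (ρ : ℕ → V)
    (t : ℕ) : Fin m → V :=
  σ (transcript G k σ ρ t)

/-- After the probe of round `t`, the candidates are the vertices on which the robber may be
standing according to all the distance vectors received so far, that is, in rounds `0, …, t`. -/
def candidates (G : SimpleGraph V) (k : ℕ) {m : ℕ} (σ : Strategy V m) (ρ : ℕ → V) (t : ℕ) :
    Set V :=
  {x | ∃ ρ' : ℕ → V, IsTrajectory G ρ' ∧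
    transcript G k σ ρ' (t + 1) = transcript G k σ ρ (t + 1) ∧ ρ' t = x}

/-- `m` cops win the `k`-visibility localization game on `G`: they have a strategy that, whatever
the robber does, leads in some round to a unique candidate, namely the position of the robber. -/
def LocalizationWin (G : SimpleGraph V) (k m : ℕ) : Prop :=
  ∃ σ : Strategy V m, ∀ ρ : ℕ → V, IsTrajectory G ρ → ∃ t, candidates G k σ ρ t = {ρ t}

/-- `m` cops win the `k`-proximity game on `G`: they have a strategy that, whatever the robber
does, leads in some round to a cop within distance `k` of the robber. -/
def ProximityWin (G : SimpleGraph V) (k m : ℕ) : Prop :=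
  ∃ σ : Strategy V m, ∀ ρ : ℕ → V, IsTrajectory G ρ →
    ∃ t i, G.edist (placement G k σ ρ t i) (ρ t) ≤ (k : ℕ∞)

/-- The `k`-visibility localization number `ζ_k(G)` of a finite graph. -/
noncomputable def localizationNumber (G : SimpleGraph V) (k : ℕ) : ℕ :=
  sInf {m : ℕ | 0 < m ∧ LocalizationWin G k m}

/-- The `k`-proximity number `prox_k(G)` of a finite graph. -/
noncomputable def proximityNumber (G : SimpleGraph V) (k : ℕ) : ℕ :=
  sInf {m : ℕ | 0 < m ∧ ProximityWin G k m}

/-- One cop on every vertex wins, so the minimum defining `ζ_k(G)` is attained. -/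
theorem localizationWin_exists [Fintype V] [Nonempty V] (G : SimpleGraph V) (k : ℕ) :
    {m : ℕ | 0 < m ∧ LocalizationWin G k m}.Nonempty := by
  refine ⟨Fintype.card V, Fintype.card_pos, fun _ i => (Fintype.equivFin V).symm i, ?_⟩
  intro ρ hρ
  refine ⟨0, Set.eq_singleton_iff_unique_mem.2 ⟨⟨ρ, hρ, rfl, rfl⟩, ?_⟩⟩
  rintro x ⟨ρ', -, h, rfl⟩
  simp only [transcript, List.nil_append, List.cons.injEq, and_true] at h
  have h := congrFun h (Fintype.equivFin V (ρ 0))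
  by_contra hne
  have h0 : G.edist (ρ 0) (ρ' 0) ≠ 0 := fun h0 => hne (SimpleGraph.edist_eq_zero_iff.1 h0).symm
  simp only [signal, Equiv.symm_apply_apply, SimpleGraph.edist_self, zero_le, if_true] at h
  split_ifs at h
  · exact h0 h
  · exact absurd h (by simp)

/-- One cop on every vertex wins, so the minimum defining `prox_k(G)` is attained. -/
theorem proximityWin_exists [Fintype V] [Nonempty V] (G : SimpleGraph V) (k : ℕ) :
    {m : ℕ | 0 < m ∧ ProximityWin G k m}.Nonempty := by
  refine ⟨Fintype.card V, Fintype.card_pos, fun _ i => (Fintype.equivFin V).symm i, ?_⟩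
  intro ρ _
  exact ⟨0, Fintype.equivFin V (ρ 0), by simp [placement]⟩

end VisibilityGame

namespace VisibilityGame

/-! ### Reduction to probes fixed in advance. -/

section OpenLoop

/-! The tree is a complete ternary tree with every edge subdivided into a path of length `2 * k +
1`, continued down to depth `d`, where the vertices at depth `d - 1` get `q - 1` children. A probe
sees at most one branch vertex (`IsSubdivided.eq_of_edist_le`), so in a block of `2 * k + 1` rounds
`m` cops see at most `M = m * (2 * k + 1)` of them. The robber crosses a subdivided edge in one
block, unseen if neither end is seen (`IsSubdivided.exists_move`).

Proximity cops learn nothing before they win, so their probes may be fixed. The set of branch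
vertices available to an undetected robber then never drops below about half of the ternary tree of
depth `4 * M` (`le_card_move`): the seen vertices remove at most `M`, while a set of about half the
tree has at least `2 * M` boundary vertices, of which at most `M` are seen.

The isoperimetric bound `two_mul_le_card_boundary` rests on ternary digits. A set is a signed sum of
the complete subtrees cut off by its boundary edges (`sum_boundary_terms`), and twice the size of
such a subtree is a power of 3 minus 1. With few boundary vertices, twice the cardinality is
therefore close to a sum of few powers of 3. But half of `3 ^ (h + 1)` has all ternary digits equal
to 1. The subadditive `digitWeight` makes this quantitative: at most `5 / 6` per boundary vertex
against about `1 / 2` per digit.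

For the comparison of the two numbers, cops who localize a never-seen robber can be made to catch
him soon after; when `k = 0` this needs the absence of closed twins. -/

theorem signal_eq_top_iff {V : Type*} (G : SimpleGraph V) (k : ℕ) (c x : V) :
    signal G k c x = ⊤ ↔ ¬ G.edist c x ≤ (k : ℕ∞) := by
  unfold signal
  split_ifs with h
  · simp only [h, not_true, iff_false]
    exact ne_top_of_le_ne_top (ENat.natCast_ne_top k) h
  · simp [h]

/-- The probes made by a strategy as long as nothing is seen. -/
def openLoop {V : Type*} {m : ℕ} (σ : Strategy V m) (t : ℕ) : Fin m → V :=
  σ (List.replicate t fun _ => ⊤)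

theorem transcript_length {V : Type*} (G : SimpleGraph V) (k : ℕ) {m : ℕ} (σ : Strategy V m)
    (ρ : ℕ → V) (t : ℕ) : (transcript G k σ ρ t).length = t := by
  induction t with
  | zero => rfl
  | succ t ih => simp [transcript, ih]

/-- While only `⊤` is received, the strategy stays on its open-loop probes, so being unseen can be
tested against a fixed sequence instead of the recursive transcript. -/
theorem transcript_eq_replicate_iff {V : Type*} (G : SimpleGraph V) (k : ℕ) {m : ℕ}
    (σ : Strategy V m) (ρ : ℕ → V) (t : ℕ) :
    transcript G k σ ρ t = List.replicate t (fun _ => ⊤) ↔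
      ∀ s < t, ∀ i, ¬ G.edist (openLoop σ s i) (ρ s) ≤ (k : ℕ∞) := by
  induction t with
  | zero => simp [transcript]
  | succ t ih =>
    rw [List.replicate_succ', transcript]
    constructor
    · intro h
      obtain ⟨h1, h2⟩ := List.append_inj' h rfl
      intro s hs i
      rcases Nat.lt_succ_iff_lt_or_eq.1 hs with hs | rfl
      · exact ih.1 h1 s hs i
      · rw [h1] at h2
        exact (signal_eq_top_iff G k _ _).1 (congrFun (List.singleton_injective h2) i)
    · intro h
      have h1 := ih.2 fun s hs => h s (hs.trans (Nat.lt_succ_self t))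
      rw [h1]
      congr 2
      funext i
      exact (signal_eq_top_iff G k _ _).2 (h t (Nat.lt_succ_self t) i)

/-- In the proximity game the cops can fix all their probes in advance. -/
theorem proximityWin_iff {V : Type*} (G : SimpleGraph V) (k m : ℕ) :
    ProximityWin G k m ↔ ∃ P : ℕ → Fin m → V, ∀ ρ : ℕ → V, IsTrajectory G ρ →
      ∃ t i, G.edist (P t i) (ρ t) ≤ (k : ℕ∞) := by
  constructor
  · rintro ⟨σ, hσ⟩
    refine ⟨openLoop σ, fun ρ hρ => ?_⟩
    by_contra! hcon
    obtain ⟨t, i, hti⟩ := hσ ρ hρ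
    rw [placement, (transcript_eq_replicate_iff G k σ ρ t).2
      fun s _ i => not_le.2 (hcon s i)] at hti
    exact absurd hti (not_le.2 (hcon t i))
  · rintro ⟨P, hP⟩
    refine ⟨fun l => P l.length, fun ρ hρ => ?_⟩
    obtain ⟨t, i, hti⟩ := hP ρ hρ
    exact ⟨t, i, by rwa [placement, transcript_length]⟩

/-- If the cops win the localization game but not the proximity game, then some fixed sequence of
probes determines the position of a robber that has never been seen. -/
theorem exists_forced_position {V : Type*} {G : SimpleGraph V} {k m : ℕ}
    (hloc : LocalizationWin G k m) (hprox : ¬ ProximityWin G k m) :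
    ∃ (P : ℕ → Fin m → V) (t : ℕ) (v : V), ∀ ρ : ℕ → V, IsTrajectory G ρ →
      (∀ s ≤ t, ∀ i, ¬ G.edist (P s i) (ρ s) ≤ (k : ℕ∞)) → ρ t = v := by
  obtain ⟨σ, hσ⟩ := hloc
  rw [proximityWin_iff] at hprox
  push Not at hprox
  obtain ⟨ρ, hρ, hev⟩ := hprox (openLoop σ)
  obtain ⟨t, ht⟩ := hσ ρ hρ
  refine ⟨openLoop σ, t, ρ t, fun ρ' hρ' h => ?_⟩
  -- Two never-seen trajectories have the same transcript.
  have hmem : ρ' t ∈ candidates G k σ ρ t := by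
    refine ⟨ρ', hρ', ?_, rfl⟩
    rw [(transcript_eq_replicate_iff G k σ ρ (t + 1)).2 fun s _ i => not_le.2 (hev s i),
      (transcript_eq_replicate_iff G k σ ρ' (t + 1)).2 fun s hs => h s (Nat.lt_succ_iff.1 hs)]
  rwa [ht] at hmem

end OpenLoop

/-! ### Localization is at least as hard as proximity. -/

section Localization

/-- A robber known to be at `v` is within distance `1 ≤ k` of a cop placed on `v` in the next round.
-/
theorem proximityWin_of_localizationWin_of_pos {V : Type*} {G : SimpleGraph V} {k m : ℕ}
    (hk : 0 < k) (hm : 0 < m) (hloc : LocalizationWin G k m) : ProximityWin G k m := by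
  by_contra hprox
  obtain ⟨P, t, v, hv⟩ := exists_forced_position hloc hprox
  refine hprox ((proximityWin_iff G k m).2 ⟨fun s => if s ≤ t then P s else fun _ => v, ?_⟩)
  intro ρ hρ
  by_contra! hcon
  have hvt : ρ t = v := hv ρ hρ fun s hs i => by
    have := hcon s i
    rw [if_pos hs] at this
    exact not_le.2 this
  have h1 := hcon (t + 1) ⟨0, hm⟩
  rw [if_neg (by omega)] at h1
  refine absurd h1 (not_lt.2 (le_trans ?_ (Nat.one_le_cast.2 hk)))
  rcases hρ t with h | h
  · rw [h, hvt, SimpleGraph.edist_self]; exact zero_le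
  · rw [← hvt]
    exact (SimpleGraph.edist_eq_one_iff_adj.2 h).le

theorem exists_range_supset {V : Type*} [Finite V] [Nonempty V] {m : ℕ} (S : Set V)
    (hS : S.ncard ≤ m) : ∃ f : Fin m → V, S ⊆ Set.range f := by
  classical
  have := Fintype.ofFinite V
  have hc : Fintype.card S ≤ Fintype.card (Fin m) := by
    rw [Fintype.card_fin, ← Nat.card_eq_fintype_card]; exact hS
  obtain ⟨e⟩ := Function.Embedding.nonempty_of_card_le hc
  refine ⟨fun i => if h : ∃ x : S, e x = i then (h.choose : V) else Classical.arbitrary V, ?_⟩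
  intro x hx
  have h : ∃ y : S, e y = e ⟨x, hx⟩ := ⟨_, rfl⟩
  refine ⟨e ⟨x, hx⟩, ?_⟩
  simp only [h, dif_pos]
  exact congrArg Subtype.val (e.injective h.choose_spec)

/-- Truncating a trajectory after round `t` and making one more lazy step to `y`. -/
theorem isTrajectory_extend {V : Type*} {G : SimpleGraph V} {ρ : ℕ → V} (hρ : IsTrajectory G ρ)
    (t : ℕ) {y : V} (hy : y = ρ t ∨ G.Adj (ρ t) y) :
    IsTrajectory G (fun s => if s ≤ t then ρ s else y) := by
  intro s
  rcases lt_trichotomy s t with h | rfl | h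
  · simpa [h.le, Nat.succ_le_of_lt h] using hρ s
  · simpa using hy
  · left; simp [not_le.2 h, not_le.2 (h.trans (Nat.lt_succ_self s))]

/-- Without closed twins, localization with visibility `0` is at least as hard as proximity. -/
theorem proximityWin_of_localizationWin_zero {V : Type*} [Finite V] [Nontrivial V]
    {G : SimpleGraph V} {m : ℕ}
    (htwin : ∀ x y : V, x ≠ y → ∃ z, ¬ ((z = x ∨ G.Adj x z) ↔ (z = y ∨ G.Adj y z)))
    (hloc : LocalizationWin G 0 m) : ProximityWin G 0 m := by
  classical
  by_contra hprox
  obtain ⟨P, hex⟩ := exists_forced_position hloc hprox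
  simp only [Nat.cast_zero, nonpos_iff_eq_zero, SimpleGraph.edist_eq_zero_iff] at hex
  -- Positions just before probe `t` of a robber missed by all earlier probes.
  set C : ℕ → Set V := fun t =>
    {y | ∃ ρ : ℕ → V, IsTrajectory G ρ ∧ ρ t = y ∧ ∀ s < t, ∀ i, P s i ≠ ρ s} with hC
  have hforced : ∃ t, ∃ v, ∀ y ∈ C t, y ∉ Set.range (P t) → y = v := by
    obtain ⟨t, v, hv⟩ := hex
    refine ⟨t, v, ?_⟩
    rintro y ⟨ρ, hρ, rfl, hev⟩ hy
    refine hv ρ hρ fun s hs i hi => ?_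
    rcases hs.lt_or_eq with h | rfl
    · exact hev s h i hi
    · exact hy ⟨i, hi⟩
  let t := Nat.find hforced
  obtain ⟨v, hv⟩ := Nat.find_spec hforced
  -- `B` is the set of survivors of the previous probe (all of `V` if `t = 0`). Minimality of `t`
  -- gives it two elements, and their closed neighbourhoods lie in `C t`.
  obtain ⟨B, hB, hBC⟩ : ∃ B : Set V, B.Nontrivial ∧ ∀ x ∈ B, ∀ y, (y = x ∨ G.Adj x y) → y ∈ C t := by
    rcases Nat.eq_zero_or_pos t with ht | ht
    · refine ⟨Set.univ, Set.nontrivial_univ, fun x _ y _ => ?_⟩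
      rw [ht]
      exact ⟨fun _ => y, fun _ => Or.inl rfl, rfl, fun s hs => absurd hs (Nat.not_lt_zero s)⟩
    · refine ⟨C (t - 1) \ Set.range (P (t - 1)), ?_, ?_⟩
      · have hmin := Nat.find_min hforced (m := t - 1) (Nat.sub_lt ht one_pos)
        rw [← Set.not_subsingleton_iff]
        intro hsub
        rcases hsub.eq_empty_or_singleton with h | ⟨x, hx⟩
        · exact hmin ⟨v, fun y hy hy' => absurd (h ▸ ⟨hy, hy'⟩ : y ∈ (∅ : Set V)) (by simp)⟩
        · exact hmin ⟨x, fun y hy hy' => (hx ▸ ⟨hy, hy'⟩ : y ∈ ({x} : Set V))⟩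
      · rintro x ⟨⟨ρ, hρ, rfl, hev⟩, hx⟩ y hy
        refine ⟨_, isTrajectory_extend hρ (t - 1) hy, by simp [Nat.sub_lt ht one_pos], ?_⟩
        intro s hs i
        have hs' : s ≤ t - 1 := by omega
        simp only [hs', if_true]
        rcases hs'.lt_or_eq with h | rfl
        · exact hev s h i
        · exact fun h => hx ⟨i, h⟩
  have hcard : (C t).ncard ≤ m + 1 := by
    have hsub : C t ⊆ insert v (Set.range (P t)) := by
      intro y hy
      by_cases h : y ∈ Set.range (P t)
      · exact Or.inr h
      · exact Or.inl (hv y hy h)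
    calc (C t).ncard ≤ (insert v (Set.range (P t))).ncard := Set.ncard_le_ncard hsub
      _ ≤ (Set.range (P t)).ncard + 1 := Set.ncard_insert_le _ _
      _ ≤ m + 1 := by
        rw [← Set.image_univ]
        have := Set.ncard_image_le (f := P t) (s := Set.univ) Set.finite_univ
        simpa using this
  -- Two vertices of `B` are not closed twins, so their closed neighbourhoods cannot both be all of
  -- `C t`; a proper one has at most `m` vertices.
  have hlt : ∃ x ∈ B, {y | y = x ∨ G.Adj x y} ⊂ C t := by
    obtain ⟨x, hx, y, hy, hxy⟩ := hB
    by_contra! hcon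
    have hEq : ∀ w ∈ B, {z | z = w ∨ G.Adj w z} = C t := fun w hw =>
      (Set.Subset.antisymm_iff.2 ⟨fun z hz => hBC w hw z hz, by
        by_contra hns
        exact hcon w hw ⟨fun z hz => hBC w hw z hz, hns⟩⟩)
    obtain ⟨z, hz⟩ := htwin x y hxy
    apply hz
    have h := (hEq x hx).trans (hEq y hy).symm
    exact Set.ext_iff.1 h z
  obtain ⟨x, hxB, hx⟩ := hlt
  have hxC : x ∈ C t := hBC x hxB x (Or.inl rfl)
  have hxm : {y | y = x ∨ G.Adj x y}.ncard ≤ m := by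
    have := Set.ncard_lt_ncard hx
    omega
  have hCm : (C t \ {x}).ncard ≤ m := by
    rw [Set.ncard_sdiff_singleton_of_mem hxC]; omega
  obtain ⟨f, hf⟩ := exists_range_supset _ hCm
  obtain ⟨g, hg⟩ := exists_range_supset _ hxm
  -- Round `t` probes all of `C t` except `x`; a robber still missed is at `x`, and round `t + 1`
  -- covers its closed neighbourhood.
  refine hprox ((proximityWin_iff G 0 m).2
    ⟨fun s => if s < t then P s else if s = t then f else g, fun ρ hρ => ?_⟩)
  simp only [Nat.cast_zero, nonpos_iff_eq_zero, SimpleGraph.edist_eq_zero_iff]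
  by_contra! hcon
  have h1 : ρ t ∈ C t := ⟨ρ, hρ, rfl, fun s hs i => by simpa [hs] using hcon s i⟩
  have h2 : ρ t = x := by
    by_contra hne
    obtain ⟨i, hi⟩ := hf ⟨h1, hne⟩
    exact hcon t i (by simpa using hi)
  have h3 := hρ t
  rw [h2] at h3
  obtain ⟨i, hi⟩ := hg h3
  exact hcon (t + 1) i (by simpa using hi)

theorem proximityWin_of_localizationWin {V : Type*} [Finite V] [Nontrivial V]
    {G : SimpleGraph V} {k m : ℕ} (hm : 0 < m)
    (htwin : ∀ x y : V, x ≠ y → ∃ z, ¬ ((z = x ∨ G.Adj x z) ↔ (z = y ∨ G.Adj y z)))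
    (hloc : LocalizationWin G k m) : ProximityWin G k m := by
  rcases Nat.eq_zero_or_pos k with rfl | hk
  · exact proximityWin_of_localizationWin_zero htwin hloc
  · exact proximityWin_of_localizationWin_of_pos hk hm hloc

theorem proximityNumber_le_localizationNumber {V : Type*} [Finite V] [Nontrivial V]
    {G : SimpleGraph V} (k : ℕ)
    (htwin : ∀ x y : V, x ≠ y → ∃ z, ¬ ((z = x ∨ G.Adj x z) ↔ (z = y ∨ G.Adj y z))) :
    proximityNumber G k ≤ localizationNumber G k := by
  have := Fintype.ofFinite V
  obtain ⟨h0, h1⟩ := Nat.sInf_mem (localizationWin_exists G k)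
  exact Nat.sInf_le ⟨h0, proximityWin_of_localizationWin h0 htwin h1⟩

end Localization

/-! ### Compactness of the space of trajectories. -/

section Evasion

/-- Compactness: if the robber can evade fixed probes for any finite time, he can do so forever. -/
theorem exists_evading_trajectory {V : Type*} [Finite V] {G : SimpleGraph V} {k m : ℕ}
    (P : ℕ → Fin m → V)
    (h : ∀ n, ∃ ρ : ℕ → V, IsTrajectory G ρ ∧ ∀ s < n, ∀ i, ¬ G.edist (P s i) (ρ s) ≤ (k : ℕ∞)) :
    ∃ ρ : ℕ → V, IsTrajectory G ρ ∧ ∀ s i, ¬ G.edist (P s i) (ρ s) ≤ (k : ℕ∞) := by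
  -- With finite discrete `V` the product `ℕ → V` is compact, and each condition involves only one
  -- or two coordinates, hence is closed.
  let _ : TopologicalSpace V := ⊥
  have _ : DiscreteTopology V := ⟨rfl⟩
  have hstep : ∀ s, IsClosed {ρ : ℕ → V | ρ (s + 1) = ρ s ∨ G.Adj (ρ s) (ρ (s + 1))} := fun s =>
    IsClosed.preimage (f := fun ρ : ℕ → V => (ρ s, ρ (s + 1)))
      ((continuous_apply s).prodMk (continuous_apply (s + 1)))
      (isClosed_discrete {p : V × V | p.2 = p.1 ∨ G.Adj p.1 p.2})
  have hev : ∀ s i, IsClosed {ρ : ℕ → V | ¬ G.edist (P s i) (ρ s) ≤ (k : ℕ∞)} := fun s i =>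
    IsClosed.preimage (f := fun ρ : ℕ → V => ρ s) (continuous_apply s)
      (isClosed_discrete {x : V | ¬ G.edist (P s i) x ≤ (k : ℕ∞)})
  let K : ℕ → Set (ℕ → V) := fun n =>
    {ρ | IsTrajectory G ρ ∧ ∀ s < n, ∀ i, ¬ G.edist (P s i) (ρ s) ≤ (k : ℕ∞)}
  have hK : ∀ n, IsClosed (K n) := by
    intro n
    have : K n = (⋂ s, {ρ : ℕ → V | ρ (s + 1) = ρ s ∨ G.Adj (ρ s) (ρ (s + 1))}) ∩
        ⋂ s, ⋂ (_ : s < n), ⋂ i, {ρ : ℕ → V | ¬ G.edist (P s i) (ρ s) ≤ (k : ℕ∞)} := by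
      ext ρ; simp [K, IsTrajectory]
    rw [this]
    exact (isClosed_iInter hstep).inter
      (isClosed_iInter fun s => isClosed_iInter fun _ => isClosed_iInter fun i => hev s i)
  obtain ⟨ρ, hρ⟩ := IsCompact.nonempty_iInter_of_sequence_nonempty_isCompact_isClosed K
    (fun n ρ hρ => ⟨hρ.1, fun s hs => hρ.2 s (hs.trans (Nat.lt_succ_self n))⟩) h
    (hK 0).isCompact hK
  rw [Set.mem_iInter] at hρ
  exact ⟨ρ, (hρ 0).1, fun s => (hρ (s + 1)).2 s (Nat.lt_succ_self s)⟩

end Evasion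

/-! ### Spherically symmetric trees. -/

section SymmetricTree

/-- A list (last letter first) describes a vertex of the spherically symmetric tree in which every
vertex at depth `j` has `c j` children if every letter is smaller than the number of children at
its depth. -/
def IsVertex (c : ℕ → ℕ) : List ℕ → Prop
  | [] => True
  | a :: l => a < c l.length ∧ IsVertex c l

/-- The vertices of the spherically symmetric rooted tree with `c j` children at depth `j`. -/
@[ext]
structure Vertex (c : ℕ → ℕ) : Type where
  /-- The word of the vertex. -/
  val : List ℕ
  /-- The letters are in range. -/
  isVertex : IsVertex c val

/-- The spherically symmetric rooted tree with `c j` children at depth `j`. -/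
def symTree (c : ℕ → ℕ) : SimpleGraph (Vertex c) where
  Adj x y := ∃ a, x.1 = a :: y.1 ∨ y.1 = a :: x.1
  symm := ⟨fun _ _ ⟨a, h⟩ => ⟨a, h.symm⟩⟩
  loopless := ⟨fun x ⟨a, h⟩ => by
    rcases h with h | h <;> exact absurd (congrArg List.length h) (by simp)⟩

/-- The root. -/
def symRoot (c : ℕ → ℕ) : Vertex c := ⟨[], trivial⟩

theorem symTree_adj {c : ℕ → ℕ} {x y : Vertex c} :
    (symTree c).Adj x y ↔ ∃ a, x.1 = a :: y.1 ∨ y.1 = a :: x.1 := Iff.rfl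

theorem IsVertex.tail {c : ℕ → ℕ} {l : List ℕ} (h : IsVertex c l) : IsVertex c l.tail := by
  cases l with
  | nil => trivial
  | cons a l => exact h.2

theorem IsVertex.drop {c : ℕ → ℕ} {l : List ℕ} (h : IsVertex c l) (n : ℕ) :
    IsVertex c (l.drop n) := by
  induction n generalizing l with
  | zero => exact h
  | succ n ih =>
    rw [← List.drop_tail]
    exact ih h.tail

theorem IsVertex.length_le {c : ℕ → ℕ} {d : ℕ} (hc : ∀ j, d ≤ j → c j = 0) {l : List ℕ}
    (h : IsVertex c l) : l.length ≤ d := by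
  cases l with
  | nil => simp
  | cons a l =>
    by_contra hlt
    have := h.1
    rw [hc _ (by simp at hlt; omega)] at this
    omega

theorem finite_vertex {c : ℕ → ℕ} {d : ℕ} (hc : ∀ j, d ≤ j → c j = 0) : Finite (Vertex c) := by
  have hlevel : ∀ n, {l | IsVertex c l ∧ l.length = n}.Finite := by
    intro n
    induction n with
    | zero => exact (Set.finite_singleton []).subset fun l hl => List.eq_nil_of_length_eq_zero hl.2
    | succ n ih =>
      refine ((Set.finite_Iio (c n)).image2 (fun a l => a :: l) ih).subset ?_
      rintro (_ | ⟨a, l⟩) ⟨h1, h2⟩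
      · simp at h2
      · have h3 : l.length = n := by simpa using h2
        exact ⟨a, h3 ▸ h1.1, l, ⟨h1.2, h3⟩, rfl⟩
  have hall : {l | IsVertex c l}.Finite := by
    refine ((Set.finite_Iic d).biUnion fun n _ => hlevel n).subset fun l hl => ?_
    simp only [Set.mem_iUnion, Set.mem_Iic]
    exact ⟨l.length, hl.length_le hc, hl, rfl⟩
  have := hall.to_subtype
  exact Finite.of_injective (fun x : Vertex c => (⟨x.1, x.2⟩ : {l | IsVertex c l}))
    fun x y h => Vertex.ext (congrArg Subtype.val h)

theorem exists_walk_to_root {c : ℕ → ℕ} (l : List ℕ) (hl : IsVertex c l) :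
    ∃ p : (symTree c).Walk (symRoot c) ⟨l, hl⟩, p.length = l.length := by
  induction l with
  | nil => exact ⟨.nil, rfl⟩
  | cons a l ih =>
    obtain ⟨p, hp⟩ := ih hl.2
    have hadj : (symTree c).Adj ⟨l, hl.2⟩ ⟨a :: l, hl⟩ := ⟨a, Or.inr rfl⟩
    exact ⟨p.concat hadj, by rw [SimpleGraph.Walk.length_concat, hp, List.length_cons]⟩

theorem symTree_connected (c : ℕ → ℕ) : (symTree c).Connected := by
  have hroot : ∀ x : Vertex c, (symTree c).Reachable (symRoot c) x := fun x =>
    (exists_walk_to_root x.1 x.2).elim fun p _ => p.reachable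
  exact { preconnected := fun x y => (hroot x).symm.trans (hroot y), nonempty := ⟨symRoot c⟩ }

/-- The edges correspond to the non-root vertices via the edge to the parent, so this connected
graph has one edge fewer than vertices. -/
theorem symTree_isTree {c : ℕ → ℕ} [Finite (Vertex c)] : (symTree c).IsTree := by
  rw [SimpleGraph.isTree_iff_connected_and_card]
  refine ⟨symTree_connected c, ?_⟩
  have hadj : ∀ x : {x : Vertex c // x ≠ symRoot c},
      (symTree c).Adj x.1 ⟨x.1.1.tail, x.1.2.tail⟩ := by
    rintro ⟨⟨_ | ⟨a, l⟩, hl⟩, hx⟩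
    · exact absurd rfl hx
    · exact ⟨a, Or.inl rfl⟩
  let e : {x : Vertex c // x ≠ symRoot c} → (symTree c).edgeSet := fun x =>
    ⟨s(x.1, ⟨x.1.1.tail, x.1.2.tail⟩), hadj x⟩
  have he : Function.Bijective e := by
    constructor
    · intro x y hxy
      have h := congrArg Subtype.val hxy
      rcases Sym2.eq_iff.1 h with ⟨h, -⟩ | ⟨h1, h2⟩
      · exact Subtype.ext h
      · obtain ⟨a, ha⟩ := hadj x
        obtain ⟨b, hb⟩ := hadj y
        have e1 := congrArg (fun z : Vertex c => z.1.length) h1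
        have e2 := congrArg (fun z : Vertex c => z.1.length) h2
        simp only [List.length_tail] at e1 e2
        have : x.1 = symRoot c := Vertex.ext (List.eq_nil_of_length_eq_zero (by omega))
        exact absurd this x.2
    · rintro ⟨s, hs⟩
      induction s using Sym2.ind with
      | _ x y =>
        have key : ∀ (x y : Vertex c) (a : ℕ), x.1 = a :: y.1 →
            ∃ z, (e z).1 = s(x, y) := by
          intro x y a h
          refine ⟨⟨x, fun hx => ?_⟩, ?_⟩
          · rw [hx] at h
            exact absurd h.symm (List.cons_ne_nil _ _)
          · have : y = ⟨x.1.tail, x.2.tail⟩ := Vertex.ext (by simp [h])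
            simp only [e, ← this]
        obtain ⟨a, h | h⟩ := symTree_adj.1 hs
        · obtain ⟨z, hz⟩ := key x y a h
          exact ⟨z, Subtype.ext hz⟩
        · obtain ⟨z, hz⟩ := key y x a h
          exact ⟨z, Subtype.ext (hz.trans Sym2.eq_swap)⟩
  have hcard := Nat.card_congr (Equiv.ofBijective e he)
  rw [← hcard]
  classical
  have := Fintype.ofFinite (Vertex c)
  rw [Nat.card_eq_fintype_card, Nat.card_eq_fintype_card, Fintype.card_subtype_compl,
    Fintype.card_subtype_eq]
  have : 0 < Fintype.card (Vertex c) := Fintype.card_pos_iff.2 ⟨symRoot c⟩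
  omega

/-- A property of balls can be proved by adding one step at a time. -/
theorem ball_induction {V : Type*} {G : SimpleGraph V} {x : V} {p : ℕ → V → Prop} (h0 : p 0 x)
    (hmono : ∀ n v, p n v → p (n + 1) v)
    (hstep : ∀ n v w, p n v → G.Adj v w → p (n + 1) w) {n : ℕ} {v : V}
    (hv : G.edist x v ≤ n) : p n v := by
  have hwalk : ∀ {a b : V} (q : G.Walk a b) (n : ℕ), p n a → p (n + q.length) b := by
    intro a b q
    induction q with
    | nil => exact fun n h => h
    | cons hadj q ih =>
      intro n h
      have := ih (n + 1) (hstep n _ _ h hadj)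
      rwa [SimpleGraph.Walk.length_cons, Nat.add_comm q.length 1, ← Nat.add_assoc]
  obtain ⟨q, hq⟩ := SimpleGraph.exists_walk_of_edist_ne_top
    (ne_top_of_le_ne_top (ENat.natCast_ne_top n) hv)
  rw [← hq] at hv
  have hle : q.length ≤ n := by exact_mod_cast hv
  have h := hwalk q 0 h0
  rw [Nat.zero_add] at h
  obtain ⟨e, rfl⟩ := Nat.exists_eq_add_of_le hle
  clear hq hv hle
  induction e with
  | zero => exact h
  | succ e ih => exact hmono _ _ ih

theorem edist_root (c : ℕ → ℕ) (x : Vertex c) :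
    (symTree c).edist (symRoot c) x = (x.1.length : ℕ∞) := by
  obtain ⟨p, hp⟩ := exists_walk_to_root x.1 x.2
  refine le_antisymm (hp ▸ SimpleGraph.edist_le p) ?_
  obtain ⟨q, hq⟩ := (symTree_connected c).exists_walk_length_eq_edist (symRoot c) x
  rw [← hq]
  have := ball_induction (G := symTree c) (x := symRoot c) (p := fun n v => v.1.length ≤ n)
    (by simp [symRoot]) (fun n v h => h.trans (Nat.le_succ n))
    (fun n v w h hadj => by
      obtain ⟨a, h' | h'⟩ := hadj <;> have := congrArg List.length h' <;> simp at this <;> omega)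
    (n := q.length) hq.symm.le
  exact_mod_cast this

theorem exists_vertex_length {c : ℕ → ℕ} {d : ℕ} (hc : ∀ j < d, 0 < c j) :
    ∃ x : Vertex c, x.1.length = d := by
  have h : ∀ n ≤ d, IsVertex c (List.replicate n 0) := by
    intro n
    induction n with
    | zero => exact fun _ => trivial
    | succ n ih =>
      intro hn
      exact ⟨by simpa using hc n hn, ih (by omega)⟩
  exact ⟨⟨_, h d le_rfl⟩, by simp⟩

theorem symTree_eccent {c : ℕ → ℕ} {d : ℕ} (hc : ∀ j < d, 0 < c j) (hc' : ∀ j, d ≤ j → c j = 0) :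
    (symTree c).eccent (symRoot c) = (d : ℕ∞) := by
  refine le_antisymm (iSup_le fun x => ?_) ?_
  · rw [edist_root]
    exact_mod_cast x.2.length_le hc'
  · obtain ⟨x, hx⟩ := exists_vertex_length hc
    rw [← hx, ← edist_root]
    exact SimpleGraph.edist_le_eccent

/-- The value `q` is attained at depth `d - 1`: `q - 1` children and a parent, which exists because
`2 ≤ d`. -/
theorem symTree_maxDegree {c : ℕ → ℕ} [Fintype (Vertex c)] [DecidableRel (symTree c).Adj] {d q : ℕ}
    (hd : 2 ≤ d) (hq : 0 < q) (hpos : ∀ j < d, 0 < c j) (hle : ∀ j, c j ≤ q - 1)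
    (hlast : c (d - 1) = q - 1) : (symTree c).maxDegree = q := by
  classical
  have himage : ∀ x : Vertex c, ((symTree c).neighborFinset x).image Vertex.val ⊆
      insert x.1.tail ((Finset.range (c x.1.length)).image fun a => a :: x.1) := by
    intro x l hl
    obtain ⟨y, hy, rfl⟩ := Finset.mem_image.1 hl
    rw [SimpleGraph.mem_neighborFinset] at hy
    obtain ⟨a, h | h⟩ := hy
    · simp [h]
    · refine Finset.mem_insert_of_mem (Finset.mem_image.2 ⟨a, Finset.mem_range.2 ?_, h.symm⟩)
      have := y.2
      rw [h] at this
      exact this.1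
  have hinj : ∀ x : Vertex c, (((symTree c).neighborFinset x).image Vertex.val).card =
      (symTree c).degree x := fun x => Finset.card_image_of_injective _ fun _ _ => Vertex.ext
  refine le_antisymm (SimpleGraph.maxDegree_le_of_forall_degree_le _ _ fun x => ?_) ?_
  · rw [← hinj]
    refine (Finset.card_le_card (himage x)).trans ((Finset.card_insert_le _ _).trans ?_)
    have h1 := Finset.card_image_le (s := Finset.range (c x.1.length)) (f := fun a => a :: x.1)
    have h2 := hle x.1.length
    rw [Finset.card_range] at h1
    omega
  · obtain ⟨x, hx⟩ := exists_vertex_length (c := c) (d := d - 1) fun j hj => hpos j (by omega)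
    refine le_trans ?_ ((symTree c).degree_le_maxDegree x)
    have hsub : insert x.1.tail ((Finset.range (c x.1.length)).image fun a => a :: x.1) ⊆
        ((symTree c).neighborFinset x).image Vertex.val := by
      intro l hl
      rcases Finset.mem_insert.1 hl with rfl | hl
      · refine Finset.mem_image.2 ⟨⟨x.1.tail, x.2.tail⟩, ?_, rfl⟩
        rw [SimpleGraph.mem_neighborFinset]
        obtain ⟨_ | ⟨a, l⟩, hl⟩ := x
        · simp at hx; omega
        · exact ⟨a, Or.inl rfl⟩
      · obtain ⟨a, ha, rfl⟩ := Finset.mem_image.1 hl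
        refine Finset.mem_image.2 ⟨⟨a :: x.1, Finset.mem_range.1 ha, x.2⟩, ?_, rfl⟩
        rw [SimpleGraph.mem_neighborFinset]
        exact ⟨a, Or.inr rfl⟩
    rw [← hinj]
    refine le_trans ?_ (Finset.card_le_card hsub)
    rw [Finset.card_insert_of_notMem, Finset.card_image_of_injective _ (fun a b h => by simpa using h),
      Finset.card_range, hx, hlast]
    · omega
    · intro h
      obtain ⟨a, -, h⟩ := Finset.mem_image.1 h
      have := congrArg List.length h
      simp at this
      omega

/-- Of two adjacent vertices the upper one has a neighbour the lower one lacks: its parent or, at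
the root, another child, whence `2 ≤ c 0`. Non-adjacent vertices are separated by one of themselves.
-/
theorem symTree_no_twins {c : ℕ → ℕ} (hc : 2 ≤ c 0) (x y : Vertex c) (hxy : x ≠ y) :
    ∃ z, ¬ ((z = x ∨ (symTree c).Adj x z) ↔ (z = y ∨ (symTree c).Adj y z)) := by
  have key : ∀ x y : Vertex c, ∀ a, x.1 = a :: y.1 →
      ∃ z, (z = y ∨ (symTree c).Adj y z) ∧ ¬ (z = x ∨ (symTree c).Adj x z) := by
    rintro x ⟨_ | ⟨b, l⟩, hl⟩ a h
    · have hz : IsVertex c [if a = 0 then 1 else 0] := by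
        refine ⟨?_, trivial⟩
        change _ < c 0
        split_ifs <;> omega
      refine ⟨⟨_, hz⟩, Or.inr ⟨_, Or.inr rfl⟩, ?_⟩
      rintro (h' | ⟨e, h' | h'⟩)
      · have := congrArg Vertex.val h'
        rw [h] at this
        split_ifs at this with h0
        · simp [h0] at this
        · simp only [List.cons.injEq, and_true] at this; exact h0 this.symm
      · rw [h] at h'
        simp at h'
      · rw [h] at h'
        simp at h'
    · refine ⟨⟨l, hl.2⟩, Or.inr ⟨b, Or.inl rfl⟩, ?_⟩
      rintro (h' | ⟨e, h' | h'⟩)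
      · have := congrArg (fun v : Vertex c => v.1.length) h'
        simp [h] at this
        omega
      · have := congrArg List.length h'
        simp [h] at this
      · have := congrArg List.length h'
        simp [h] at this
        omega
  by_contra! hcon
  rcases (hcon x).1 (Or.inl rfl) with h | ⟨a, h | h⟩
  · exact hxy h
  · obtain ⟨z, h1, h2⟩ := key y x a h
    exact h2 ((hcon z).1 h1)
  · obtain ⟨z, h1, h2⟩ := key x y a h
    exact h2 ((hcon z).2 h1)

end SymmetricTree
-- Distance to the nearest integer as a measure of ternary digits.
section NearestInteger

/-- The distance from a real number to the nearest integer. -/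
noncomputable def intDist (x : ℝ) : ℝ := |x - round x|

theorem intDist_le (x : ℝ) (z : ℤ) : intDist x ≤ |x - z| := round_le x z

theorem intDist_le_abs (x : ℝ) : intDist x ≤ |x| := by simpa using intDist_le x 0

theorem intDist_add_le (x y : ℝ) : intDist (x + y) ≤ intDist x + intDist y := by
  refine (intDist_le (x + y) (round x + round y)).trans ?_
  refine le_trans (le_of_eq ?_) (abs_add_le (x - round x) (y - round y))
  push_cast
  ring_nf

theorem intDist_intCast (z : ℤ) : intDist z = 0 := by simp [intDist]

theorem le_intDist_of_odd {N : ℕ} (hN : Odd N) (x : ℝ) : 1 / 2 - |x - N / 2| ≤ intDist x := by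
  have h : (1 / 2 : ℝ) ≤ |(N : ℝ) / 2 - round x| := by
    obtain ⟨a, rfl⟩ := hN
    have hint : (1 : ℝ) ≤ |((2 * a + 1 - 2 * round x : ℤ) : ℝ)| := by
      rw [← Int.cast_abs]
      exact_mod_cast Int.one_le_abs (by omega)
    have heq : (((2 * a + 1 : ℕ) : ℝ) / 2 - round x) = ((2 * a + 1 - 2 * round x : ℤ) : ℝ) / 2 := by
      push_cast; ring
    rw [heq, abs_div, abs_two]
    linarith
  have h2 := abs_sub_le ((N : ℝ) / 2) x (round x)
  rw [abs_sub_comm ((N : ℝ) / 2) x] at h2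
  unfold intDist
  linarith

/-- The sum of the distances of `x / 3 ^ i` to the nearest integer, for `3 ≤ i < n + 3`. It measures
how many nonzero ternary digits `x` has. -/
noncomputable def digitWeight (n : ℕ) (x : ℝ) : ℝ := ∑ i ∈ Finset.range n, intDist (x / 3 ^ (i + 3))

theorem digitWeight_zero (n : ℕ) : digitWeight n 0 = 0 := by
  simp [digitWeight, intDist]

theorem digitWeight_add_le (n : ℕ) (x y : ℝ) :
    digitWeight n (x + y) ≤ digitWeight n x + digitWeight n y := by
  unfold digitWeight
  rw [← Finset.sum_add_distrib]
  refine Finset.sum_le_sum fun i _ => ?_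
  rw [add_div]
  exact intDist_add_le _ _

theorem digitWeight_sum_le {ι : Type*} (n : ℕ) (s : Finset ι) (f : ι → ℝ) :
    digitWeight n (∑ i ∈ s, f i) ≤ ∑ i ∈ s, digitWeight n (f i) :=
  Finset.le_sum_of_subadditive _ (digitWeight_zero n).le (digitWeight_add_le n) s f

theorem sum_inv_pow_three_le (n : ℕ) : ∑ i ∈ Finset.range n, (1 : ℝ) / 3 ^ (i + 3) ≤ 1 / 18 := by
  have h : ∑ i ∈ Finset.range n, (1 : ℝ) / 3 ^ (i + 3) = 1 / 18 - 1 / 18 / 3 ^ n := by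
    induction n with
    | zero => norm_num
    | succ n ih =>
      rw [Finset.sum_range_succ, ih]
      field_simp
      ring
  rw [h]
  have : (0 : ℝ) ≤ 1 / 18 / 3 ^ n := by positivity
  linarith

/-- Starting at the exponent 3 makes bounded errors cheap: the geometric series sums to at most `1 /
18`. -/
theorem digitWeight_le_abs (n : ℕ) (x : ℝ) : digitWeight n x ≤ |x| / 18 := by
  calc digitWeight n x ≤ ∑ i ∈ Finset.range n, |x| * (1 / 3 ^ (i + 3)) := by
        refine Finset.sum_le_sum fun i _ => (intDist_le_abs _).trans (le_of_eq ?_)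
        rw [abs_div, abs_of_pos (by positivity : (0 : ℝ) < 3 ^ (i + 3))]
        ring
    _ ≤ |x| / 18 := by
        rw [← Finset.mul_sum]
        have := mul_le_mul_of_nonneg_left (sum_inv_pow_three_le n) (abs_nonneg x)
        linarith

theorem intDist_div_three_le (z : ℤ) : intDist ((z : ℝ) / 3) ≤ 1 / 3 := by
  have h : ∃ y : ℤ, |z - 3 * y| ≤ 1 := ⟨(z + 1) / 3, by rw [abs_le]; omega⟩
  obtain ⟨y, hy⟩ := h
  refine (intDist_le _ y).trans ?_
  have h1 : |((z - 3 * y : ℤ) : ℝ)| ≤ 1 := by rw [← Int.cast_abs]; exact_mod_cast hy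
  have h2 : (z : ℝ) / 3 - y = ((z - 3 * y : ℤ) : ℝ) / 3 := by push_cast; ring
  rw [h2, abs_div, abs_of_pos (by norm_num : (0 : ℝ) < 3)]
  linarith

/-- Terms with `i + 3 ≤ j` vanish, the next one is at most `1 / 3`, and the later ones at most `2 /
9 + 2 / 27 + ... = 1 / 3`. The subtracted `3 ^ j / 3 ^ (n + 2)` is the tail of this series not yet
used, which lets the induction on `n` close. -/
theorem digitWeight_mul_pow_le_of_abs_le_two (n j : ℕ) (z : ℤ) (hz : |z| ≤ 2) :
    digitWeight n (z * 3 ^ j) ≤ if n + 2 ≤ j then 0 else 2 / 3 - 3 ^ j / 3 ^ (n + 2) := by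
  induction n with
  | zero =>
    simp only [digitWeight, Finset.range_zero, Finset.sum_empty]
    split_ifs with h
    · exact le_rfl
    · have : j ≤ 1 := by omega
      interval_cases j <;> norm_num
  | succ n ih =>
    have hsucc : digitWeight (n + 1) (z * 3 ^ j) =
        digitWeight n (z * 3 ^ j) + intDist (z * 3 ^ j / 3 ^ (n + 3)) := Finset.sum_range_succ _ _
    rw [hsucc]
    rcases lt_trichotomy j (n + 2) with h | rfl | h
    · rw [if_neg (by omega)] at ih ⊢
      have h1 : intDist (z * 3 ^ j / 3 ^ (n + 3)) ≤ 2 * (3 ^ j / 3 ^ (n + 3)) := by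
        refine (intDist_le_abs _).trans ?_
        rw [mul_div_assoc, abs_mul, abs_of_pos (by positivity : (0 : ℝ) < 3 ^ j / 3 ^ (n + 3))]
        refine mul_le_mul_of_nonneg_right ?_ (by positivity)
        rw [← Int.cast_abs]; exact_mod_cast hz
      have h2 : (3 : ℝ) ^ j / 3 ^ (n + 2) = 3 * (3 ^ j / 3 ^ (n + 3)) := by
        rw [pow_succ 3 (n + 2)]; field_simp
      have h3 : n + 1 + 2 = n + 3 := rfl
      rw [h3]
      linarith
    · rw [if_pos le_rfl] at ih
      rw [if_neg (by omega)]
      have h1 : (z : ℝ) * 3 ^ (n + 2) / 3 ^ (n + 3) = z / 3 := by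
        rw [pow_succ 3 (n + 2)]; field_simp
      have h2 : (3 : ℝ) ^ (n + 2) / 3 ^ (n + 1 + 2) = 1 / 3 := by
        rw [show n + 1 + 2 = (n + 2) + 1 by ring, pow_succ 3 (n + 2)]; field_simp
      rw [h1, h2]
      have := intDist_div_three_le z
      linarith
    · rw [if_pos (by omega)] at ih ⊢
      have h1 : (z : ℝ) * 3 ^ j / 3 ^ (n + 3) = ((z * 3 ^ (j - (n + 3)) : ℤ) : ℝ) := by
        obtain ⟨c, rfl⟩ := Nat.exists_eq_add_of_le (show n + 3 ≤ j from h)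
        rw [Nat.add_sub_cancel_left, pow_add]
        push_cast
        field_simp
      rw [h1, intDist_intCast]
      linarith

theorem digitWeight_mul_pow_le (n j : ℕ) (z : ℤ) (hz : |z| ≤ 3) :
    digitWeight n (z * 3 ^ j) ≤ 2 / 3 := by
  have key : ∀ (j : ℕ) (z : ℤ), |z| ≤ 2 → digitWeight n (z * 3 ^ j) ≤ 2 / 3 := by
    intro j z hz
    refine (digitWeight_mul_pow_le_of_abs_le_two n j z hz).trans ?_
    split_ifs
    · norm_num
    · have : (0 : ℝ) ≤ 3 ^ j / 3 ^ (n + 2) := by positivity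
      linarith
  by_cases h2 : |z| ≤ 2
  · exact key j z h2
  · have h3 : |z| = 3 := by omega
    rcases (abs_eq (by norm_num)).1 h3 with rfl | rfl
    · have := key (j + 1) 1 (by norm_num)
      convert this using 2
      push_cast; ring
    · have := key (j + 1) (-1) (by norm_num)
      convert this using 2
      push_cast; ring

/-- Each `x / 3 ^ (i + 3)` is within `W / 3 ^ (i + 3)` of `3 ^ (n - i) / 2`, half an odd integer, so
every term is nearly `1 / 2`. -/
theorem le_digitWeight (n : ℕ) (x W : ℝ) (hx : |x - 3 ^ (n + 3) / 2| ≤ W) :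
    (n : ℝ) / 2 - W / 18 ≤ digitWeight n x := by
  have hW : 0 ≤ W := (abs_nonneg _).trans hx
  have hterm : ∀ i ∈ Finset.range n,
      1 / 2 - W * (1 / 3 ^ (i + 3)) ≤ intDist (x / 3 ^ (i + 3)) := by
    intro i hi
    have hi := Finset.mem_range.1 hi
    refine le_trans ?_ (le_intDist_of_odd (N := 3 ^ (n - i)) (Odd.pow (by decide)) _)
    have h1 : x / 3 ^ (i + 3) - ((3 ^ (n - i) : ℕ) : ℝ) / 2
        = (x - 3 ^ (n + 3) / 2) * (1 / 3 ^ (i + 3)) := by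
      have h2 : (3 : ℝ) ^ (n + 3) = 3 ^ (n - i) * 3 ^ (i + 3) := by rw [← pow_add]; congr 1; omega
      rw [h2]
      push_cast
      generalize (3 : ℝ) ^ (n - i) = u
      field_simp
    rw [h1, abs_mul, abs_of_pos (by positivity : (0 : ℝ) < 1 / 3 ^ (i + 3))]
    have := mul_le_mul_of_nonneg_right hx (by positivity : (0 : ℝ) ≤ 1 / 3 ^ (i + 3))
    linarith
  refine le_trans ?_ (Finset.sum_le_sum hterm)
  rw [Finset.sum_sub_distrib, ← Finset.mul_sum]
  simp only [Finset.sum_const, Finset.card_range, nsmul_eq_mul]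
  have := mul_le_mul_of_nonneg_left (sum_inv_pow_three_le n) hW
  linarith

end NearestInteger

/-! ### Isoperimetry in the complete ternary tree. -/

section TernaryWords

/-- The words of length `n` over `{0, 1, 2}`; a word is the list of its letters, the last first. -/
def words : ℕ → Finset (List ℕ)
  | 0 => {[]}
  | n + 1 => (Finset.range 3 ×ˢ words n).image fun p => p.1 :: p.2

/-- The words of length at most `h`, the vertices of the complete ternary tree of depth `h`. -/
def ternary (h : ℕ) : Finset (List ℕ) := (Finset.range (h + 1)).biUnion words

theorem cons_mem_words {n a : ℕ} {l : List ℕ} :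
    a :: l ∈ words (n + 1) ↔ a < 3 ∧ l ∈ words n := by
  simp [words]

theorem length_of_mem_words {n : ℕ} {l : List ℕ} (hl : l ∈ words n) : l.length = n := by
  induction n generalizing l with
  | zero => simp_all [words]
  | succ n ih =>
    simp only [words, Finset.mem_image, Finset.mem_product, Prod.exists] at hl
    obtain ⟨a, l, ⟨-, hl⟩, rfl⟩ := hl
    simp [ih hl]

theorem mem_ternary {h : ℕ} {l : List ℕ} : l ∈ ternary h ↔ l.length ≤ h ∧ l ∈ words l.length := by
  simp only [ternary, Finset.mem_biUnion, Finset.mem_range, Nat.lt_succ_iff]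
  constructor
  · rintro ⟨n, hn, hl⟩
    rw [length_of_mem_words hl]
    exact ⟨hn, hl⟩
  · rintro ⟨h1, h2⟩
    exact ⟨_, h1, h2⟩

theorem sum_words_succ (n : ℕ) (f : List ℕ → ℝ) :
    ∑ l ∈ words (n + 1), f l = ∑ l ∈ words n, ∑ a ∈ Finset.range 3, f (a :: l) := by
  rw [words, Finset.sum_image (by rintro ⟨a, l⟩ _ ⟨b, l'⟩ _ h; simpa using h),
    Finset.sum_product_right]

theorem sum_ternary (h : ℕ) (f : List ℕ → ℝ) :
    ∑ l ∈ ternary h, f l = ∑ n ∈ Finset.range (h + 1), ∑ l ∈ words n, f l := by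
  refine Finset.sum_biUnion ?_
  intro i _ j _ hij
  refine Finset.disjoint_left.2 fun l hi hj => hij ?_
  rw [← length_of_mem_words hi, length_of_mem_words hj]

theorem card_words (n : ℕ) : (words n).card = 3 ^ n := by
  induction n with
  | zero => rfl
  | succ n ih =>
    rw [words, Finset.card_image_of_injective _ (by rintro ⟨a, l⟩ ⟨b, l'⟩ h; simpa using h),
      Finset.card_product, ih, Finset.card_range, pow_succ']

theorem card_ternary (h : ℕ) : 2 * (ternary h).card + 1 = 3 ^ (h + 1) := by
  have h1 : (ternary h).card = ∑ n ∈ Finset.range (h + 1), 3 ^ n := by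
    rw [ternary, Finset.card_biUnion]
    · exact Finset.sum_congr rfl fun n _ => card_words n
    · intro i _ j _ hij
      refine Finset.disjoint_left.2 fun l hi hj => hij ?_
      rw [← length_of_mem_words hi, length_of_mem_words hj]
  rw [h1]
  induction h + 1 with
  | zero => rfl
  | succ n ih => rw [Finset.sum_range_succ, pow_succ]; omega

open Classical in
/-- The outer vertex boundary of a set of vertices of the complete ternary tree. -/
noncomputable def boundary (h : ℕ) (S : Finset (List ℕ)) : Finset (List ℕ) :=
  (ternary h).filter fun l => l ∉ S ∧ ((∃ a, a :: l ∈ S) ∨ ∃ a p, l = a :: p ∧ p ∈ S)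

/-- The indicator of `S` at the parent of a word (and `0` at the root). -/
def parentInd (χ : List ℕ → ℝ) : List ℕ → ℝ
  | [] => 0
  | _ :: l => χ l

/-- For an indicator `χ` of `S`: start from the whole tree if the root is in `S` and from nothing
otherwise, add the subtree below each edge whose lower end alone is in `S`, and subtract it if only
the upper end is. Twice the size of a subtree rooted at depth `n` is `3 ^ (h + 1 - n) - 1`, and each
edge is charged to its end outside `S`. The proof is a summation by parts over the levels. -/
theorem sum_boundary_terms (h : ℕ) (χ : List ℕ → ℝ) :
    ∑ n ∈ Finset.range (h + 1), ∑ l ∈ words n, (1 - χ l) *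
      ((∑ a ∈ Finset.range 3, χ (a :: l)) * (3 ^ (h - n) - 1) -
        parentInd χ l * (3 ^ (h + 1 - n) - 1)) =
    2 * (∑ n ∈ Finset.range (h + 1), ∑ l ∈ words n, χ l) - χ [] * (3 ^ (h + 1) - 1) := by
  set A : ℕ → ℝ := fun n => ∑ l ∈ words n, χ l with hA
  set C : ℕ → ℝ := fun n => ∑ l ∈ words n, parentInd χ l * χ l with hC
  set B : ℕ → ℝ := fun n => ∑ l ∈ words n, parentInd χ l with hB
  set f : ℕ → ℝ := fun n => 3 ^ (h + 1 - n) - 1 with hf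
  have hB0 : B 0 = 0 := by simp [hB, words, parentInd]
  have hC0 : C 0 = 0 := by simp [hC, words, parentInd]
  have hA0 : A 0 = χ [] := by simp [hA, words]
  have hBs : ∀ n, B (n + 1) = 3 * A n := by
    intro n
    simp only [hB, hA, sum_words_succ, parentInd, Finset.sum_const, Finset.card_range,
      Finset.mul_sum]
    simp
  have hlevel : ∀ n, ∑ l ∈ words n, (1 - χ l) *
      ((∑ a ∈ Finset.range 3, χ (a :: l)) * (3 ^ (h - n) - 1) -
        parentInd χ l * (3 ^ (h + 1 - n) - 1)) =
      (A (n + 1) - C (n + 1)) * f (n + 1) - (B n - C n) * f n := by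
    intro n
    simp only [hA, hC, hB, hf, sum_words_succ, parentInd]
    rw [show h + 1 - (n + 1) = h - n by omega]
    simp only [← Finset.sum_sub_distrib, Finset.sum_mul]
    refine Finset.sum_congr rfl fun l _ => ?_
    simp only [Finset.sum_range_succ, Finset.sum_range_zero]
    ring
  -- Words of length `h + 1` lie outside the tree; their weight is zero.
  have hlast : f (h + 1) = 0 := by simp [hf]
  have hsum : ∑ n ∈ Finset.range (h + 1), B n * f n =
      ∑ n ∈ Finset.range (h + 1), 3 * A n * f (n + 1) := by
    rw [Finset.sum_range_succ', Finset.sum_range_succ, hlast, hB0]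
    simp [hBs]
  have hdiff : ∀ n ∈ Finset.range (h + 1), A n * f n = 3 * A n * f (n + 1) + 2 * A n := by
    intro n hn
    have hn := Finset.mem_range.1 hn
    simp only [hf]
    rw [show h + 1 - n = (h + 1 - (n + 1)) + 1 by omega, pow_succ]
    ring
  have htel := Finset.sum_range_sub (fun n => (A n - C n) * f n) (h + 1)
  have hdiffsum := Finset.sum_congr rfl hdiff
  rw [Finset.sum_add_distrib, ← Finset.mul_sum] at hdiffsum
  rw [Finset.sum_congr rfl fun n _ => hlevel n]
  have hsplit : ∑ n ∈ Finset.range (h + 1),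
      ((A (n + 1) - C (n + 1)) * f (n + 1) - (B n - C n) * f n) =
      ∑ n ∈ Finset.range (h + 1), ((A (n + 1) - C (n + 1)) * f (n + 1) - (A n - C n) * f n) +
      (∑ n ∈ Finset.range (h + 1), A n * f n - ∑ n ∈ Finset.range (h + 1), B n * f n) := by
    rw [← Finset.sum_sub_distrib, ← Finset.sum_add_distrib]
    exact Finset.sum_congr rfl fun n _ => by ring
  rw [hsplit, htel, hsum, hdiffsum, hlast, hA0, hC0]
  simp only [hf, Nat.sub_zero]
  ring

/-- The term of a boundary vertex at depth `n` with `a` children in `S`, where `e` tells whether its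
parent is in `S`. -/
theorem digitWeight_boundary_term_le (N j a e : ℕ) (ha : a ≤ 3) (he : e ≤ 1) :
    digitWeight N ((a : ℝ) * (3 ^ j - 1) - e * (3 ^ (j + 1) - 1)) ≤ 5 / 6 := by
  have h : (a : ℝ) * (3 ^ j - 1) - e * (3 ^ (j + 1) - 1) =
      ((a - 3 * e : ℤ) : ℝ) * 3 ^ j + ((e - a : ℤ) : ℝ) := by
    push_cast; ring
  have h1 := digitWeight_mul_pow_le N j (a - 3 * e : ℤ) (by rw [abs_le]; omega)
  have h2 := digitWeight_le_abs N ((e - a : ℤ) : ℝ)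
  have h3 : |((e - a : ℤ) : ℝ)| ≤ 3 := by
    rw [← Int.cast_abs]
    exact_mod_cast (show |(e - a : ℤ)| ≤ 3 by rw [abs_le]; omega)
  rw [h]
  refine (digitWeight_add_le _ _ _).trans ?_
  linarith

/-- Only boundary vertices contribute to the signed sum, and subadditivity charges `5 / 6` to each.
The contribution of the root stays apart because it has weight zero where the bound is used. -/
theorem digitWeight_le_card_boundary (N h : ℕ) {S : Finset (List ℕ)}
    (hS : S ⊆ ternary h) (ε : ℝ) (hε : ε = if [] ∈ S then 1 else 0) :
    digitWeight N (2 * S.card + ε) ≤ 5 / 6 * (boundary h S).card + digitWeight N (ε * 3 ^ (h + 1)) := by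
  classical
  set χ : List ℕ → ℝ := fun l => if l ∈ S then 1 else 0 with hχ
  have hcard : (S.card : ℝ) = ∑ n ∈ Finset.range (h + 1), ∑ l ∈ words n, χ l := by
    rw [← sum_ternary, Finset.sum_ite_mem, Finset.inter_eq_right.2 hS]
    simp
  set term : List ℕ → ℝ := fun l => (1 - χ l) *
    ((∑ a ∈ Finset.range 3, χ (a :: l)) * (3 ^ (h - l.length) - 1) -
      parentInd χ l * (3 ^ (h + 1 - l.length) - 1)) with hterm
  have hsum : ∑ l ∈ ternary h, term l = 2 * S.card - ε * (3 ^ (h + 1) - 1) := by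
    rw [hcard, hε, ← sum_boundary_terms h χ, sum_ternary]
    refine Finset.sum_congr rfl fun n _ => Finset.sum_congr rfl fun l hl => ?_
    simp only [hterm, length_of_mem_words hl]
  have hzero : ∀ l ∈ ternary h, l ∉ boundary h S → term l = 0 := by
    intro l hl hlb
    by_cases hlS : l ∈ S
    · simp [hterm, hχ, hlS]
    · simp only [boundary, Finset.mem_filter, hl, hlS, not_false_eq_true, true_and, not_or,
        not_exists, not_and] at hlb
      have h1 : ∀ a, χ (a :: l) = 0 := fun a => if_neg (hlb.1 a)
      have h2 : parentInd χ l = 0 := by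
        cases l with
        | nil => rfl
        | cons a p => exact if_neg (hlb.2 a p rfl)
      simp [hterm, h1, h2]
  have hle : ∀ l ∈ boundary h S, digitWeight N (term l) ≤ 5 / 6 := by
    intro l hl
    simp only [boundary, Finset.mem_filter] at hl
    have hlen := (mem_ternary.1 hl.1).1
    have h1 : ∑ a ∈ Finset.range 3, χ (a :: l) =
        (((Finset.range 3).filter fun a => a :: l ∈ S).card : ℝ) := by
      simp [hχ, Finset.sum_boole]
    have h2 : ∃ e : ℕ, e ≤ 1 ∧ parentInd χ l = e := by
      cases l with
      | nil => exact ⟨0, by omega, by simp [parentInd]⟩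
      | cons a p =>
        by_cases hp : p ∈ S
        · exact ⟨1, le_rfl, by simp [parentInd, hχ, hp]⟩
        · exact ⟨0, by omega, by simp [parentInd, hχ, hp]⟩
    obtain ⟨e, he, he'⟩ := h2
    have h3 : χ l = 0 := if_neg hl.2.1
    simp only [hterm, h1, he', h3, sub_zero, one_mul]
    rw [show h + 1 - l.length = (h - l.length) + 1 by omega]
    exact digitWeight_boundary_term_le N _ _ e ((Finset.card_filter_le _ _).trans (by simp)) he
  have heq : 2 * (S.card : ℝ) + ε = ∑ l ∈ boundary h S, term l + ε * 3 ^ (h + 1) := by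
    have hsub : boundary h S ⊆ ternary h := Finset.filter_subset _ _
    rw [Finset.sum_subset hsub hzero, hsum]
    ring
  rw [heq]
  refine (digitWeight_add_le _ _ _).trans (add_le_add_left ?_ _)
  refine (digitWeight_sum_le _ _ _).trans ((Finset.sum_le_card_nsmul _ _ _ hle).trans (le_of_eq ?_))
  rw [nsmul_eq_mul, mul_comm]

/-- Sets of about half of the vertices of the complete ternary tree of depth `4 * M` have at least
`2 * M` boundary vertices. -/
theorem two_mul_le_card_boundary {M : ℕ} (hM : 0 < M) {S : Finset (List ℕ)}
    (hS : S ⊆ ternary (4 * M)) (h1 : 3 ^ (4 * M + 1) / 4 + 1 ≤ S.card + M)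
    (h2 : S.card < 3 ^ (4 * M + 1) / 4 + 1) : 2 * M ≤ (boundary (4 * M) S).card := by
  set ε : ℝ := if [] ∈ S then 1 else 0 with hε
  have hε0 : 0 ≤ ε := by rw [hε]; split_ifs <;> norm_num
  have hε1 : ε ≤ 1 := by rw [hε]; split_ifs <;> norm_num
  -- With `n = 4 * M - 2` the centre `3 ^ (n + 3) / 2` of `le_digitWeight` is half of `3 ^ (4 * M +
  -- 1)`, and the root term is an integer multiple of every denominator.
  have hmain := digitWeight_le_card_boundary (4 * M - 2) (4 * M) hS ε hε
  have hroot : digitWeight (4 * M - 2) (ε * 3 ^ (4 * M + 1)) ≤ 0 := by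
    rw [hε]
    split_ifs
    · have := digitWeight_mul_pow_le_of_abs_le_two (4 * M - 2) (4 * M + 1) 1 (by norm_num)
      rw [if_pos (by omega)] at this
      simpa using this
    · simp [digitWeight_zero]
  have hlow := le_digitWeight (4 * M - 2) (2 * S.card + ε) (2 * M) (by
    rw [show 4 * M - 2 + 3 = 4 * M + 1 by omega]
    have e1 : 3 ^ (4 * M + 1) ≤ 4 * (3 ^ (4 * M + 1) / 4) + 3 := by omega
    have e2 : 4 * (3 ^ (4 * M + 1) / 4) ≤ 3 ^ (4 * M + 1) := by omega
    generalize 3 ^ (4 * M + 1) / 4 = y at e1 e2 h1 h2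
    have e1' : (3 : ℝ) ^ (4 * M + 1) ≤ 4 * y + 3 := by exact_mod_cast e1
    have e2' : 4 * (y : ℝ) ≤ 3 ^ (4 * M + 1) := by exact_mod_cast e2
    have h1' : (y : ℝ) + 1 ≤ S.card + M := by exact_mod_cast h1
    have h2' : (S.card : ℝ) + 1 ≤ y + 1 := by exact_mod_cast h2
    have hM' : (1 : ℝ) ≤ M := by exact_mod_cast hM
    rw [abs_le]
    constructor <;> linarith)
  -- Otherwise `2 * M - 1 - M / 9 ≤ 5 / 6 * (2 * M - 1)`, that is `2 * M / 9 ≤ 1 / 6`, impossible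
  -- for `M ≥ 1`.
  by_contra! hcon
  have hcon' : ((boundary (4 * M) S).card : ℝ) + 1 ≤ 2 * M := by exact_mod_cast hcon
  have hM' : (1 : ℝ) ≤ M := by exact_mod_cast hM
  rw [Nat.cast_sub (by omega)] at hlow
  push_cast at hlow
  linarith

open Classical in
/-- One round of the game on the ternary tree: if `M` vertices `P` are forbidden at the beginning
and at the end of a move, then the set of possible positions does not fall below the threshold. -/
theorem le_card_move {M : ℕ} (hM : 0 < M) {X P : Finset (List ℕ)} (hX : X ⊆ ternary (4 * M))
    (hP : P.card ≤ M) (hcard : 3 ^ (4 * M + 1) / 4 + 1 ≤ X.card) :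
    3 ^ (4 * M + 1) / 4 + 1 ≤ ((X \ P) ∪ (boundary (4 * M) (X \ P) \ P)).card := by
  have h1 := Finset.le_card_sdiff P X
  by_cases hlt : (X \ P).card < 3 ^ (4 * M + 1) / 4 + 1
  · have h2 := two_mul_le_card_boundary hM (Finset.sdiff_subset.trans hX) (by omega) hlt
    have h3 := Finset.le_card_sdiff P (boundary (4 * M) (X \ P))
    rw [Finset.card_union_of_disjoint]
    · omega
    · refine Finset.disjoint_left.2 fun l hl hl' => ?_
      exact (Finset.mem_filter.1 (Finset.mem_sdiff.1 hl').1).2.1 hl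
  · exact (not_lt.1 hlt).trans (Finset.card_le_card Finset.subset_union_left)

end TernaryWords
-- The subdivided ternary tree and its balls.
section Subdivision

/-- The vertex at distance `i` above `x` (the root if there is none). -/
def Vertex.ancestor {c : ℕ → ℕ} (x : Vertex c) (i : ℕ) : Vertex c := ⟨x.1.drop i, x.2.drop i⟩

theorem Vertex.ancestor_succ {c : ℕ → ℕ} (x : Vertex c) (i : ℕ) :
    x.ancestor (i + 1) = x.ancestor i ∨ (symTree c).Adj (x.ancestor i) (x.ancestor (i + 1)) := by
  have h : (x.ancestor (i + 1)).1 = (x.ancestor i).1.tail := by simp [ancestor]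
  rcases hx : (x.ancestor i).1 with _ | ⟨a, l⟩
  · left
    rw [hx] at h
    exact Vertex.ext (h.trans hx.symm)
  · right
    rw [hx] at h
    exact ⟨a, Or.inl (by rw [hx, h]; rfl)⟩

theorem Vertex.ancestor_zero {c : ℕ → ℕ} (x : Vertex c) : x.ancestor 0 = x := rfl

theorem Vertex.edist_ancestor_le {c : ℕ → ℕ} (x : Vertex c) (i n : ℕ) :
    (symTree c).edist (x.ancestor i) (x.ancestor (i + n)) ≤ n := by
  induction n with
  | zero => simp
  | succ n ih =>
    refine (SimpleGraph.edist_triangle (v := x.ancestor (i + n))).trans ?_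
    rw [Nat.cast_succ]
    refine add_le_add ih ?_
    rw [SimpleGraph.edist_le_one_iff_adj_or_eq]
    exact (x.ancestor_succ (i + n)).symm.imp_right Eq.symm

/-- The vertex of the subdivided tree (every edge replaced by a path of length `2 * k + 1`)
corresponding to a vertex of the ternary tree. -/
def embed (k : ℕ) : List ℕ → List ℕ
  | [] => []
  | a :: w => List.replicate (2 * k) 0 ++ a :: embed k w

theorem length_embed (k : ℕ) (w : List ℕ) : (embed k w).length = (2 * k + 1) * w.length := by
  induction w with
  | nil => rfl
  | cons a w ih => simp [embed, ih]; ring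

theorem embed_injective (k : ℕ) : Function.Injective (embed k) := by
  intro w w' h
  induction w generalizing w' with
  | nil =>
    cases w' with
    | nil => rfl
    | cons a w' => simp [embed] at h
  | cons a w ih =>
    cases w' with
    | nil => simp [embed] at h
    | cons b w' =>
      have h1 := List.append_cancel_left h
      rw [List.cons.injEq] at h1
      rw [h1.1, ih h1.2]

theorem drop_embed_cons {k i : ℕ} (hi : i ≤ 2 * k) (a : ℕ) (w : List ℕ) :
    (embed k (a :: w)).drop i = List.replicate (2 * k - i) 0 ++ a :: embed k w := by
  rw [embed, List.drop_append_of_le_length (by simpa using hi), List.drop_replicate]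

theorem drop_embed_cons_last (k a : ℕ) (w : List ℕ) :
    (embed k (a :: w)).drop (2 * k + 1) = embed k w := by
  rw [← List.drop_drop, drop_embed_cons le_rfl]
  simp

/-- Up to depth `(2 * k + 1) * h` the tree with `c j` children at depth `j` is the subdivided
ternary tree. -/
structure IsSubdivided (c : ℕ → ℕ) (k h : ℕ) : Prop where
  branch : ∀ n < h, c ((2 * k + 1) * n) = 3
  path : ∀ j < (2 * k + 1) * h, ¬ (2 * k + 1) ∣ j → c j = 1

theorem not_dvd_mul_add {L n r : ℕ} (h0 : 0 < r) (hr : r < L) : ¬ L ∣ L * n + r := by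
  rw [Nat.dvd_add_right (Dvd.intro n rfl)]
  exact Nat.not_dvd_of_pos_of_lt h0 hr

theorem IsSubdivided.isVertex_embed {c : ℕ → ℕ} {k h : ℕ} (hc : IsSubdivided c k h) {n : ℕ}
    (hn : n ≤ h) {w : List ℕ} (hw : w ∈ words n) : IsVertex c (embed k w) := by
  induction n generalizing w with
  | zero =>
    rw [List.eq_nil_of_length_eq_zero (length_of_mem_words hw)]
    trivial
  | succ n ih =>
    obtain _ | ⟨a, w⟩ := w
    · exact absurd (length_of_mem_words hw) (by simp)
    · obtain ⟨ha, hw⟩ := cons_mem_words.1 hw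
      have hlen : (embed k w).length = (2 * k + 1) * n := by
        rw [length_embed, length_of_mem_words hw]
      have key : ∀ m ≤ 2 * k, IsVertex c (List.replicate m 0 ++ a :: embed k w) := by
        intro m
        induction m with
        | zero =>
          intro _
          refine ⟨?_, ih (by omega) hw⟩
          rw [hlen, hc.branch n (by omega)]
          exact ha
        | succ m ihm =>
          intro hm
          refine ⟨?_, ihm (by omega)⟩
          have h1 : (2 * k + 1) * (n + 1) ≤ (2 * k + 1) * h := Nat.mul_le_mul_left _ hn
          rw [Nat.mul_succ] at h1
          have h2 : (List.replicate m 0 ++ a :: embed k w).length = (2 * k + 1) * n + (m + 1) := by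
            simp [hlen]; omega
          change 0 < c (List.replicate m 0 ++ a :: embed k w).length
          rw [h2, hc.path _ (by omega) (not_dvd_mul_add (by omega) (by omega))]
          exact one_pos
      exact key _ le_rfl

/-- A vertex in the interior of a subdivided edge has only one child. -/
theorem IsSubdivided.child_eq {c : ℕ → ℕ} {k h : ℕ} (hc : IsSubdivided c k h) {w : List ℕ}
    (hw : w.length ≤ h) {i b : ℕ} (h0 : 0 < i) (hi : i ≤ 2 * k) (hiw : i ≤ (embed k w).length)
    (hb : IsVertex c (b :: (embed k w).drop i)) :
    b :: (embed k w).drop i = (embed k w).drop (i - 1) := by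
  obtain _ | ⟨a, w⟩ := w
  · simp [embed] at hiw; omega
  · have h1 : (2 * k + 1) * (w.length + 1) ≤ (2 * k + 1) * h := Nat.mul_le_mul_left _ hw
    rw [Nat.mul_succ] at h1
    have h2 : ((embed k (a :: w)).drop i).length = (2 * k + 1) * w.length + (2 * k + 1 - i) := by
      rw [List.length_drop, length_embed, List.length_cons, Nat.mul_succ]; omega
    have h3 := hb.1
    rw [h2, hc.path _ (by omega) (not_dvd_mul_add (by omega) (by omega))] at h3
    rw [drop_embed_cons hi, drop_embed_cons (by omega), show 2 * k - (i - 1) = (2 * k - i) + 1 by omega,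
      List.replicate_succ, List.cons_append, Nat.lt_one_iff.1 h3]

/-- Whoever sees a vertex of a subdivided edge sees one of its two ends. -/
theorem IsSubdivided.edist_end_le {c : ℕ → ℕ} {k h : ℕ} (hc : IsSubdivided c k h) {w : List ℕ}
    (hw : w.length ≤ h) {y v : Vertex c} (hy : y.1 = embed k w) (hne : w ≠ []) {i : ℕ}
    (hi : i ≤ 2 * k + 1) (hv : (symTree c).edist (y.ancestor i) v ≤ k) :
    (symTree c).edist y v ≤ k ∨ (symTree c).edist (y.ancestor (2 * k + 1)) v ≤ k := by
  have hlen : 2 * k + 1 ≤ (embed k w).length := by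
    rw [length_embed]
    exact Nat.le_mul_of_pos_right _ (List.length_pos_iff.2 hne)
  have hstep1 : ∀ (n : ℕ) (x v v' : Vertex c), (symTree c).edist x v ≤ n → (symTree c).Adj v v' →
      (symTree c).edist x v' ≤ (n + 1 : ℕ) := by
    intro n x v v' h1 h2
    refine (SimpleGraph.edist_triangle (v := v)).trans ?_
    rw [Nat.cast_succ]
    exact add_le_add h1 (SimpleGraph.edist_eq_one_iff_adj.2 h2).le
  -- Interior vertices of the edge have no side branches, so a walk leaves the edge only through an
  -- end: after `n` steps it is on the edge or within `n` of an end.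
  have key := ball_induction (G := symTree c) (x := y.ancestor i) (p := fun n v =>
    (∃ j ≤ 2 * k + 1, v = y.ancestor j) ∨ (symTree c).edist y v ≤ n ∨
      (symTree c).edist (y.ancestor (2 * k + 1)) v ≤ n) (Or.inl ⟨i, hi, rfl⟩)
    (by
      have hmono : ∀ n : ℕ, (n : ℕ∞) ≤ (n + 1 : ℕ) := fun n => by exact_mod_cast Nat.le_succ n
      rintro n v (h | h | h)
      · exact Or.inl h
      · exact Or.inr (Or.inl (h.trans (hmono n)))
      · exact Or.inr (Or.inr (h.trans (hmono n))))
    (by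
      rintro n v v' (⟨j, hj, rfl⟩ | h | h) hadj
      · rcases Nat.eq_zero_or_pos j with rfl | hj0
        · right; left
          exact hstep1 n _ _ _ (by rw [Vertex.ancestor_zero, SimpleGraph.edist_self]; exact zero_le) hadj
        rcases hj.eq_or_lt with rfl | hj1
        · right; right
          exact hstep1 n _ _ _ (by rw [SimpleGraph.edist_self]; exact zero_le) hadj
        left
        obtain ⟨b, hb | hb⟩ := hadj
        · refine ⟨j + 1, hj1, Vertex.ext ?_⟩
          have := congrArg List.tail hb
          simpa [Vertex.ancestor] using this.symm
        · refine ⟨j - 1, by omega, Vertex.ext ?_⟩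
          rw [hb]
          have hv' := v'.2
          rw [hb] at hv'
          simp only [Vertex.ancestor, hy] at hv' ⊢
          exact hc.child_eq hw hj0 (by omega) (by omega) hv'
      · exact Or.inr (Or.inl (hstep1 n _ _ _ h hadj))
      · exact Or.inr (Or.inr (hstep1 n _ _ _ h hadj)))
    hv
  rcases key with ⟨j, hj, rfl⟩ | h | h
  -- The edge has length `2 * k + 1`, so each of its vertices is within `k` of an end.
  · rcases Nat.lt_or_ge k j with hkj | hkj
    · right
      rw [SimpleGraph.edist_comm]
      have := y.edist_ancestor_le j (2 * k + 1 - j)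
      rw [Nat.add_sub_cancel' hj] at this
      exact this.trans (by exact_mod_cast (by omega : 2 * k + 1 - j ≤ k))
    · left
      have := y.edist_ancestor_le 0 j
      rw [Nat.zero_add, Vertex.ancestor_zero] at this
      exact this.trans (by exact_mod_cast hkj)
  · exact Or.inl h
  · exact Or.inr h

/-- Going up at most `2 * k` steps from a branch vertex meets only unbranched vertices of one
subdivided edge, so turning back leads down the same path. -/
theorem IsSubdivided.mem_ball {c : ℕ → ℕ} {k h : ℕ} (hc : IsSubdivided c k h) {w : List ℕ}
    (hw : w.length ≤ h) {x v : Vertex c} (hx : x.1 = embed k w) {n : ℕ} (hn : n ≤ 2 * k)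
    (hv : (symTree c).edist x v ≤ n) :
    (∃ i ≤ n, i ≤ (embed k w).length ∧ v.1 = (embed k w).drop i) ∨
      ∃ s, s.length ≤ n ∧ v.1 = s ++ embed k w := by
  refine ball_induction (G := symTree c) (x := x) (p := fun n v => n ≤ 2 * k →
    (∃ i ≤ n, i ≤ (embed k w).length ∧ v.1 = (embed k w).drop i) ∨
      ∃ s, s.length ≤ n ∧ v.1 = s ++ embed k w) ?_ ?_ ?_ hv hn
  · exact fun _ => Or.inl ⟨0, le_rfl, Nat.zero_le _, hx⟩
  · intro n v h hn
    rcases h (by omega) with ⟨i, h1, h2⟩ | ⟨s, h1, h2⟩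
    · exact Or.inl ⟨i, by omega, h2⟩
    · exact Or.inr ⟨s, by omega, h2⟩
  · intro n v v' h hadj hn
    have key : (∃ i ≤ n, i ≤ (embed k w).length ∧ v.1 = (embed k w).drop i) →
        (∃ i ≤ n + 1, i ≤ (embed k w).length ∧ v'.1 = (embed k w).drop i) ∨
        ∃ s, s.length ≤ n + 1 ∧ v'.1 = s ++ embed k w := by
      rintro ⟨i, hi, hiw, hvi⟩
      obtain ⟨b, hb | hb⟩ := hadj
      · rw [hvi] at hb
        refine Or.inl ⟨i + 1, by omega, ?_, ?_⟩
        · have := congrArg List.length hb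
          simp only [List.length_drop, List.length_cons] at this
          omega
        · have := congrArg List.tail hb
          simpa using this.symm
      · rcases Nat.eq_zero_or_pos i with rfl | hi0
        · exact Or.inr ⟨[b], by simp, by rw [hb, hvi]; rfl⟩
        · have hv' := v'.2
          rw [hb, hvi] at hv'
          refine Or.inl ⟨i - 1, by omega, by omega, ?_⟩
          rw [hb, hvi]
          exact hc.child_eq hw hi0 (by omega) hiw hv'
    rcases h (by omega) with h | ⟨s, h1, h2⟩
    · exact key h
    · obtain _ | ⟨e, s⟩ := s
      · exact key ⟨0, Nat.zero_le _, Nat.zero_le _, h2⟩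
      · right
        obtain ⟨b, hb | hb⟩ := hadj
        · rw [h2, List.cons_append, List.cons.injEq] at hb
          exact ⟨s, by simp at h1; omega, hb.2.symm⟩
        · exact ⟨b :: e :: s, by simp at h1 ⊢; omega, by rw [hb, h2]; rfl⟩

/-- A vertex is within distance `k` of at most one branch vertex. -/
theorem IsSubdivided.eq_of_edist_le {c : ℕ → ℕ} {k h : ℕ} (hc : IsSubdivided c k h)
    {w w' : List ℕ} (hw : w.length ≤ h) (hw' : w'.length ≤ h) {x x' v : Vertex c}
    (hx : x.1 = embed k w) (hx' : x'.1 = embed k w') (hv : (symTree c).edist x v ≤ k)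
    (hv' : (symTree c).edist x' v ≤ k) : w = w' := by
  -- Branch vertices have depths divisible by `2 * k + 1`, so the depth of `v` determines its
  -- offsets, which are at most `k`; `hmul` serves offsets on the same side and `hmul'` offsets on
  -- opposite sides.
  have hmul : ∀ a b i j : ℕ, i ≤ k → j ≤ k → (2 * k + 1) * a + i = (2 * k + 1) * b + j →
      a = b ∧ i = j := by
    intro a b i j hi hj heq
    have h1 := congrArg (· % (2 * k + 1)) heq
    simp only [Nat.mul_add_mod] at h1
    rw [Nat.mod_eq_of_lt (by omega), Nat.mod_eq_of_lt (by omega)] at h1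
    subst h1
    exact ⟨Nat.eq_of_mul_eq_mul_left (by omega : 0 < 2 * k + 1) (by omega), rfl⟩
  have hmul' : ∀ a b i j : ℕ, i ≤ k → j ≤ k → (2 * k + 1) * a = (2 * k + 1) * b + i + j →
      i = 0 ∧ j = 0 := by
    intro a b i j hi hj heq
    have h1 := congrArg (· % (2 * k + 1)) heq
    simp only [Nat.add_assoc, Nat.mul_add_mod, Nat.mul_mod_right] at h1
    rw [Nat.mod_eq_of_lt (by omega)] at h1
    omega
  have hcross : ∀ (w w' : List ℕ) (i : ℕ) (s : List ℕ), i ≤ k → i ≤ (embed k w).length →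
      s.length ≤ k → (embed k w).drop i = s ++ embed k w' → w = w' := by
    intro w w' i s hi hiw hs heq
    have hlen := congrArg List.length heq
    rw [List.length_drop, List.length_append] at hlen
    simp only [length_embed] at hlen hiw
    obtain ⟨rfl, h2⟩ := hmul' w.length w'.length i s.length hi hs (by omega)
    rw [List.eq_nil_of_length_eq_zero h2] at heq
    exact embed_injective k heq
  rcases hc.mem_ball hw hx (by omega) hv with ⟨i, hi, hiw, hvi⟩ | ⟨s, hs, hvs⟩ <;>
  rcases hc.mem_ball hw' hx' (by omega) hv' with ⟨i', hi', hiw', hvi'⟩ | ⟨s', hs', hvs'⟩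
  · have heq := hvi.symm.trans hvi'
    have hlen := congrArg List.length heq
    simp only [List.length_drop, length_embed] at hlen hiw hiw'
    obtain ⟨h1, rfl⟩ := hmul w.length w'.length i' i hi' hi (by omega)
    obtain _ | ⟨a, w⟩ := w <;> obtain _ | ⟨a', w'⟩ := w'
    · rfl
    · simp at h1
    · simp at h1
    · rw [drop_embed_cons (by omega), drop_embed_cons (by omega)] at heq
      have := List.append_cancel_left heq
      rw [List.cons.injEq] at this
      rw [this.1, embed_injective k this.2]
  · exact hcross w w' i s' hi hiw hs' (hvi.symm.trans hvs')
  · exact (hcross w' w i' s hi' hiw' hs (hvi'.symm.trans hvs)).symm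
  · have heq := hvs.symm.trans hvs'
    have hlen := congrArg List.length heq
    simp only [List.length_append, length_embed] at hlen
    obtain ⟨h1, h2⟩ := hmul w.length w'.length s.length s'.length hs hs' (by omega)
    exact embed_injective k (List.append_inj' heq (by simp [length_embed, h1])).2

end Subdivision

/-! ### The evasion strategy, in blocks of `2 * k + 1` rounds. -/

section Robber

theorem isTrajectory_append {V : Type*} {G : SimpleGraph V} {ρ τ : ℕ → V} (hρ : IsTrajectory G ρ)
    (hτ : IsTrajectory G τ) {n : ℕ} (h : τ 0 = ρ n) :
    IsTrajectory G (fun t => if t ≤ n then ρ t else τ (t - n)) := by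
  intro t
  rcases lt_trichotomy t n with ht | rfl | ht
  · simpa [ht.le, Nat.succ_le_of_lt ht] using hρ t
  · have := hτ 0
    rw [h] at this
    simpa using this
  · have := hτ (t - n)
    rw [← Nat.sub_add_comm ht.le] at this
    simpa [not_le.2 ht, not_le.2 (ht.trans (Nat.lt_succ_self t))] using this

/-- The relation of being equal or adjacent in the ternary tree. -/
def LazyStep (w w' : List ℕ) : Prop := w' = w ∨ (∃ a, w = a :: w') ∨ ∃ a, w' = a :: w

/-- The robber can make a lazy step of the ternary tree in `2 * k + 1` rounds, being seen only from
places that see one of the two ends. -/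
theorem IsSubdivided.exists_move {c : ℕ → ℕ} {k h : ℕ} (hc : IsSubdivided c k h) {w w' : List ℕ}
    (hw : w.length ≤ h) (hw' : w'.length ≤ h) {x x' : Vertex c} (hx : x.1 = embed k w)
    (hx' : x'.1 = embed k w') (hstep : LazyStep w w') :
    ∃ τ : ℕ → Vertex c, IsTrajectory (symTree c) τ ∧ τ 0 = x ∧ τ (2 * k + 1) = x' ∧
      ∀ j v, (symTree c).edist v (τ j) ≤ k →
        (symTree c).edist v x ≤ k ∨ (symTree c).edist v x' ≤ k := by
  rcases hstep with rfl | ⟨a, rfl⟩ | ⟨a, rfl⟩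
  · have : x = x' := Vertex.ext (hx.trans hx'.symm)
    subst this
    exact ⟨fun _ => x, fun _ => Or.inl rfl, rfl, rfl, fun _ _ h => Or.inl h⟩
  · have hend : x.ancestor (2 * k + 1) = x' :=
      Vertex.ext (by simp only [Vertex.ancestor, hx, hx', drop_embed_cons_last])
    refine ⟨fun j => x.ancestor (min j (2 * k + 1)), fun j => ?_, rfl, by simpa using hend, ?_⟩
    · rcases Nat.lt_or_ge j (2 * k + 1) with hj | hj
      · simpa [min_eq_left hj.le, min_eq_left (Nat.succ_le_of_lt hj)] using x.ancestor_succ j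
      · left; simp [min_eq_right hj, min_eq_right (hj.trans (Nat.le_succ j))]
    · intro j v hv
      rw [SimpleGraph.edist_comm] at hv
      rw [SimpleGraph.edist_comm, SimpleGraph.edist_comm (v := x'), ← hend]
      exact hc.edist_end_le hw hx (List.cons_ne_nil _ _) (min_le_right _ _) hv
  · have hend : x'.ancestor (2 * k + 1) = x :=
      Vertex.ext (by simp only [Vertex.ancestor, hx, hx', drop_embed_cons_last])
    refine ⟨fun j => x'.ancestor (2 * k + 1 - j), fun j => ?_, hend, by simp [Vertex.ancestor_zero], ?_⟩
    · rcases Nat.lt_or_ge j (2 * k + 1) with hj | hj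
      · have := x'.ancestor_succ (2 * k + 1 - (j + 1))
        rw [show 2 * k + 1 - (j + 1) + 1 = 2 * k + 1 - j by omega] at this
        exact this.imp Eq.symm fun h => h.symm
      · left; simp [Nat.sub_eq_zero_of_le hj, Nat.sub_eq_zero_of_le (hj.trans (Nat.le_succ j))]
    · intro j v hv
      rw [SimpleGraph.edist_comm] at hv
      rw [SimpleGraph.edist_comm, SimpleGraph.edist_comm (v := x'), ← hend]
      exact (hc.edist_end_le hw' hx' (List.cons_ne_nil _ _) (Nat.sub_le _ _) hv).symm

open Classical in
/-- The branch vertices seen by some cop in the `n`-th block of `2 * k + 1` rounds. -/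
noncomputable def seen {c : ℕ → ℕ} (k h : ℕ) {m : ℕ} (P : ℕ → Fin m → Vertex c) (n : ℕ) :
    Finset (List ℕ) :=
  (ternary h).filter fun w => ∃ j < 2 * k + 1, ∃ i, ∃ x : Vertex c, x.1 = embed k w ∧
    (symTree c).edist (P (n * (2 * k + 1) + j) i) x ≤ k

/-- Each of the `m * (2 * k + 1)` probes of a block sees at most one branch vertex. -/
theorem IsSubdivided.card_seen_le {c : ℕ → ℕ} {k h : ℕ} (hc : IsSubdivided c k h) {m : ℕ}
    (P : ℕ → Fin m → Vertex c) (n : ℕ) : (seen k h P n).card ≤ m * (2 * k + 1) := by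
  classical
  have hsub : seen k h P n ⊆ (Finset.range (2 * k + 1) ×ˢ (Finset.univ : Finset (Fin m))).biUnion
      fun p => (ternary h).filter fun w => ∃ x : Vertex c, x.1 = embed k w ∧
        (symTree c).edist (P (n * (2 * k + 1) + p.1) p.2) x ≤ k := by
    intro w hw
    obtain ⟨hw, j, hj, i, hx⟩ := Finset.mem_filter.1 hw
    exact Finset.mem_biUnion.2 ⟨(j, i), by simpa using hj, Finset.mem_filter.2 ⟨hw, hx⟩⟩
  refine (Finset.card_le_card hsub).trans
    ((Finset.card_biUnion_le_card_mul _ _ 1 fun p _ => ?_).trans (le_of_eq ?_))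
  · refine Finset.card_le_one.2 fun w hw w' hw' => ?_
    obtain ⟨hw, x, hx, hxe⟩ := Finset.mem_filter.1 hw
    obtain ⟨hw', x', hx', hxe'⟩ := Finset.mem_filter.1 hw'
    rw [SimpleGraph.edist_comm] at hxe hxe'
    exact hc.eq_of_edist_le (mem_ternary.1 hw).1 (mem_ternary.1 hw').1 hx hx' hxe hxe'
  · simp [mul_comm]

/-- `X` collects branch vertices where an unseen robber can stand just before block `n`. A block is
one move of `le_card_move`: avoiding `seen k h P n` at both ends of the move protects the whole
crossing. -/
theorem IsSubdivided.exists_positions {c : ℕ → ℕ} {k m : ℕ} (hm : 0 < m)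
    (hc : IsSubdivided c k (4 * (m * (2 * k + 1)))) (P : ℕ → Fin m → Vertex c) (n : ℕ) :
    ∃ X ⊆ ternary (4 * (m * (2 * k + 1))),
      3 ^ (4 * (m * (2 * k + 1)) + 1) / 4 + 1 ≤ X.card ∧
      ∀ w ∈ X, ∃ ρ : ℕ → Vertex c, IsTrajectory (symTree c) ρ ∧
        (ρ (n * (2 * k + 1))).1 = embed k w ∧
        ∀ s < n * (2 * k + 1), ∀ i, ¬ (symTree c).edist (P s i) (ρ s) ≤ k := by
  classical
  have hM : 0 < m * (2 * k + 1) := Nat.mul_pos hm (by omega)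
  set h := 4 * (m * (2 * k + 1)) with hh
  have hvert : ∀ w ∈ ternary h, ∃ x : Vertex c, x.1 = embed k w := fun w hw =>
    ⟨⟨_, hc.isVertex_embed (mem_ternary.1 hw).1 (mem_ternary.1 hw).2⟩, rfl⟩
  induction n with
  | zero =>
    refine ⟨ternary h, Finset.Subset.refl _, ?_, fun w hw => ?_⟩
    · have h1 := card_ternary h
      have h2 : 3 ^ 5 ≤ 3 ^ (h + 1) := Nat.pow_le_pow_right (by omega) (by omega)
      omega
    · obtain ⟨x, hx⟩ := hvert w hw
      exact ⟨fun _ => x, fun _ => Or.inl rfl, hx, fun s hs => by omega⟩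
  | succ n ih =>
    obtain ⟨X, hX, hcard, hpos⟩ := ih
    set Q := seen k h P n with hQ
    have hsub : (X \ Q) ∪ (boundary h (X \ Q) \ Q) ⊆ ternary h :=
      Finset.union_subset (Finset.sdiff_subset.trans hX)
        (Finset.sdiff_subset.trans (Finset.filter_subset _ _))
    refine ⟨_, hsub, le_card_move hM hX (hc.card_seen_le P n) hcard, fun w' hw' => ?_⟩
    have hw'h := hsub hw'
    obtain ⟨hw'Q, w, hw, hstep⟩ : w' ∉ Q ∧ ∃ w ∈ X \ Q, LazyStep w w' := by
      rcases Finset.mem_union.1 hw' with hw' | hw'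
      · exact ⟨(Finset.mem_sdiff.1 hw').2, w', hw', Or.inl rfl⟩
      · obtain ⟨hb, hwQ⟩ := Finset.mem_sdiff.1 hw'
        refine ⟨hwQ, ?_⟩
        rcases (Finset.mem_filter.1 hb).2.2 with ⟨a, ha⟩ | ⟨a, p, rfl, hp⟩
        · exact ⟨_, ha, Or.inr (Or.inl ⟨a, rfl⟩)⟩
        · exact ⟨_, hp, Or.inr (Or.inr ⟨a, rfl⟩)⟩
    obtain ⟨hwX, hwQ⟩ := Finset.mem_sdiff.1 hw
    obtain ⟨ρ, hρ, hend, hev⟩ := hpos w hwX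
    obtain ⟨x', hx'⟩ := hvert w' hw'h
    obtain ⟨τ, hτ, hτ0, hτ1, hτs⟩ := hc.exists_move (mem_ternary.1 (hX hwX)).1
      (mem_ternary.1 hw'h).1 hend hx' hstep
    refine ⟨_, isTrajectory_append hρ hτ hτ0, ?_, fun s hs i hsee => ?_⟩
    · have h1 : ¬ (n + 1) * (2 * k + 1) ≤ n * (2 * k + 1) := by rw [Nat.succ_mul]; omega
      have h2 : (n + 1) * (2 * k + 1) - n * (2 * k + 1) = 2 * k + 1 := by rw [Nat.succ_mul]; omega
      simp only [h1, if_false, h2, hτ1, hx']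
    · rw [Nat.succ_mul] at hs
      rcases Nat.lt_or_ge s (n * (2 * k + 1)) with hlt | hge
      · rw [if_pos hlt.le] at hsee
        exact hev s hlt i hsee
      · obtain ⟨j, rfl⟩ := Nat.exists_eq_add_of_le hge
        -- The glued trajectory takes the round `j = 0` from `ρ`, which agrees there with `τ 0`.
        have hsee' : (symTree c).edist (P (n * (2 * k + 1) + j) i) (τ j) ≤ k := by
          rcases Nat.eq_zero_or_pos j with rfl | hj
          · rw [hτ0]; simpa using hsee
          · rw [if_neg (by omega), Nat.add_sub_cancel_left] at hsee
            exact hsee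
        rcases hτs j _ hsee' with h1 | h1
        · exact hwQ (Finset.mem_filter.2 ⟨hX hwX, j, by omega, i, _, hend, h1⟩)
        · exact hw'Q (Finset.mem_filter.2 ⟨hw'h, j, by omega, i, _, hx', h1⟩)

theorem IsSubdivided.not_proximityWin {c : ℕ → ℕ} [Finite (Vertex c)] {k m : ℕ} (hm : 0 < m)
    (hc : IsSubdivided c k (4 * (m * (2 * k + 1)))) : ¬ ProximityWin (symTree c) k m := by
  rw [proximityWin_iff]
  rintro ⟨P, hP⟩
  obtain ⟨ρ, hρ, hev⟩ := exists_evading_trajectory (G := symTree c) (k := k) P fun n => by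
    obtain ⟨X, -, hcard, hX⟩ := hc.exists_positions hm P n
    obtain ⟨w, hw⟩ := Finset.card_pos.1 (lt_of_lt_of_le (Nat.succ_pos _) hcard)
    obtain ⟨ρ, hρ, -, hev⟩ := hX w hw
    exact ⟨ρ, hρ, fun s hs => hev s (hs.trans_le (Nat.le_mul_of_pos_right _ (by omega)))⟩
  obtain ⟨t, i, h⟩ := hP ρ hρ
  exact hev t i h

end Robber

/-! ### Choice of the arities and conclusion. -/

section Arity

/-- Numbers of children in a subdivided ternary tree of depth `d` whose last level has vertices with
`q - 1` children. -/
def arity (d q k j : ℕ) : ℕ :=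
  if d ≤ j then 0 else if j + 1 = d then q - 1 else if (2 * k + 1) ∣ j then 3 else 1

theorem arity_of_le {d q k j : ℕ} (h : d ≤ j) : arity d q k j = 0 := if_pos h

theorem arity_pos {d q k j : ℕ} (hq : 2 ≤ q) (h : j < d) : 0 < arity d q k j := by
  unfold arity; split_ifs <;> omega

theorem arity_le {d q k : ℕ} (hq : 4 ≤ q) (j : ℕ) : arity d q k j ≤ q - 1 := by
  unfold arity; split_ifs <;> omega

/-- Strictness keeps the exceptional level `d - 1` below all levels that the subdivided tree
prescribes. -/
theorem isSubdivided_arity {d q k h : ℕ} (hd : (2 * k + 1) * h < d) :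
    IsSubdivided (arity d q k) k h where
  branch n hn := by
    have : (2 * k + 1) * (n + 1) ≤ (2 * k + 1) * h := Nat.mul_le_mul_left _ hn
    rw [Nat.mul_succ] at this
    rw [arity, if_neg (by omega), if_neg (by omega), if_pos (Dvd.intro n rfl)]
  path j hj hdvd := by
    rw [arity, if_neg (by omega), if_neg (by omega), if_neg hdvd]

end Arity

end VisibilityGame

theorem mainTheorem6 (d q k : ℕ) (hd : 3 ≤ d) (hq : 4 ≤ q) :
    ∃ (V : Type) (_ : Fintype V) (T : SimpleGraph V) (_ : DecidableRel T.Adj) (r : V),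
      T.IsTree ∧ T.eccent r = (d : ℕ∞) ∧ T.maxDegree = q ∧
      VisibilityGame.localizationNumber T k ≥ VisibilityGame.proximityNumber T k ∧
      (VisibilityGame.proximityNumber T k : ℝ) >
        1 / 4 * (((d : ℝ) - ((k : ℝ) + 1)) / (2 * (k : ℝ) + 1) ^ 2) := by
  classical
  open VisibilityGame in
  have hpos : ∀ j < d, 0 < arity d q k j := fun j hj => arity_pos (by omega) hj
  have hzero : ∀ j, d ≤ j → arity d q k j = 0 := fun j hj => arity_of_le hj
  have hroot : arity d q k 0 = 3 := by
    rw [arity, if_neg (by omega), if_neg (by omega), if_pos (dvd_zero _)]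
  have hfin : Finite (Vertex (arity d q k)) := finite_vertex hzero
  have _ := Fintype.ofFinite (Vertex (arity d q k))
  have hnontriv : Nontrivial (Vertex (arity d q k)) := by
    obtain ⟨x, hx⟩ := exists_vertex_length hpos
    refine ⟨x, symRoot _, fun h => ?_⟩
    rw [h] at hx
    change 0 = d at hx
    omega
  refine ⟨Vertex (arity d q k), inferInstance, symTree (arity d q k), inferInstance,
    symRoot (arity d q k), symTree_isTree, symTree_eccent hpos hzero, ?_, ?_, ?_⟩
  · refine symTree_maxDegree (d := d) (by omega) (by omega) hpos (arity_le hq) ?_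
    rw [arity, if_neg (by omega), if_pos (by omega)]
  · exact proximityNumber_le_localizationNumber k (symTree_no_twins (by omega))
  · by_contra! hcon
    obtain ⟨hm, hwin⟩ := Nat.sInf_mem (proximityWin_exists (symTree (arity d q k)) k)
    change 0 < proximityNumber (symTree (arity d q k)) k at hm
    change ProximityWin _ k (proximityNumber (symTree (arity d q k)) k) at hwin
    generalize proximityNumber (symTree (arity d q k)) k = m at hm hwin hcon
    -- If the bound failed, the subdivided tree of depth `(2 * k + 1) * (4 * M) = 4 * m * (2 * k +
    -- 1) ^ 2`, with `M = m * (2 * k + 1)`, would fit strictly above depth `d`, and `m` cops would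
    -- lose.
    have hle : 4 * m * (2 * k + 1) ^ 2 + (k + 1) ≤ d := by
      have h2 : (m : ℝ) * 4 ≤ ((d : ℝ) - ((k : ℝ) + 1)) / (2 * (k : ℝ) + 1) ^ 2 := by linarith
      rw [le_div_iff₀ (by positivity)] at h2
      have h3 : (4 * m * (2 * k + 1) ^ 2 + (k + 1) : ℝ) ≤ d := by linarith
      exact_mod_cast h3
    refine (isSubdivided_arity ?_).not_proximityWin hm hwin
    have : (2 * k + 1) * (4 * (m * (2 * k + 1))) = 4 * m * (2 * k + 1) ^ 2 := by ring
    omega
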